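/- Let $\mathcal X\subset\mathbb R^d$ be compact and let $Y=\{Y(s)\}_{s\in\mathcal X}$ be a non-negative stochastic process with continuous sample paths such that $\mathbb E\{Y(s)\}=1$ for all $s\in\mathcal X$ and $\mathbb E\{\sup_{s\in\mathcal X}Y(s)\}<\infty$. Let $\{\zeta_i\}_{i\ge1}$ be the points of a Poisson process on $(0,\infty)$ with intensity measure $\zeta^{-2}\,d\zeta$, and let $Y_1,Y_2,\ldots$ be independent copies of $Y$ (with continuous sample paths), independent of $(\zeta_i)_{i\ge1}$. Put $\varphi_i(s)=\zeta_iY_i(s)$ and $\eta(s)=\max_{i\ge1}\varphi_i(s)$, $s\in\mathcal X$. For $k\ge2$ and $s_1,\ldots,s_k\in\mathcal X$ define the extremal concurrence probability $$p(s_1,\ldots,s_k)=\mathbb P\bigl\{\text{for some }\ell\ge1:\ \eta(s_j)=\varphi_\ell(s_j),\ j=1,\ldots,k\bigr\}.$$ Then $$p(s_1,\ldots,s_k)=\mathbb E_Y\left(\left[\mathbb E_{\tilde Y}\left\{\max_{j=1,\ldots,k}\frac{\tilde Y(s_j)}{Y(s_j)}\right\}\right]^{-1}\right),$$ where $\tilde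 Y$ is an independent copy of $Y$, $\mathbb E_{\tilde Y}$ is the expectation with respect to $\tilde Y$ with $Y$ held fixed, and quotients and expectations are taken in $[0,\infty]$ with $a/0=\infty$ for $a>0$, $0/0=0$ and $1/\infty=0$. -/

import Mathlib

open MeasureTheory ProbabilityTheory
open scoped ENNReal

noncomputable section

namespace Concurrence

/-- The number of indices `i` for which the point `ζ i` lies in `A`, i.e. the mass which the
random counting measure `∑ i, δ_{ζ i}` gives to `A` (points are counted with multiplicity). -/
def pointCount {Ω E : Type*} (ζ : ℕ → Ω → E) (A : Set E) (ω : Ω) : ℕ∞ :=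
  {i : ℕ | ζ i ω ∈ A}.encard

/-- The random points `ζ 0, ζ 1, …` (in an arbitrary measurable enumeration) are the points of a
Poisson process on `E` with intensity measure `μ`: the number of points in a measurable set `A` is
Poisson distributed with parameter `μ A` (and is almost surely infinite if `μ A = ∞`), and the
numbers of points in pairwise disjoint measurable sets are independent. -/
structure IsPoissonProcess {Ω E : Type*} [MeasurableSpace Ω] [MeasurableSpace E]
    (ζ : ℕ → Ω → E) (μ : Measure E) (P : Measure Ω) : Prop where
  measurable : ∀ i, Measurable (ζ i)
  poisson : ∀ A : Set E, MeasurableSet A → μ A ≠ ∞ →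
    ∀ n : ℕ, P {ω | pointCount ζ A ω = n} = poissonMeasure (μ A).toNNReal {n}
  infinite : ∀ A : Set E, MeasurableSet A → μ A = ∞ → ∀ᵐ ω ∂P, pointCount ζ A ω = ⊤
  indep : ∀ (m : ℕ) (A : Fin m → Set E), (∀ i, MeasurableSet (A i)) →
    Pairwise (fun i j => Disjoint (A i) (A j)) →
    iIndepFun (fun (i : Fin m) (ω : Ω) => pointCount ζ (A i) ω) P

/-- The measure `z⁻² dz` on `(0, ∞)`, as a measure on `ℝ`. -/
def inverseSquareMeasure : Measure ℝ :=
  (volume.restrict (Set.Ioi 0)).withDensity (fun z => ENNReal.ofReal ((z ^ 2)⁻¹))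

/-- A nonnegative stochastic process `Y` indexed by `T`, with continuous sample paths,
`E Y(s) = 1` for all `s`, and `E sup_s Y(s) < ∞`. -/
structure IsSpectralProcess {Ω T : Type*} [MeasurableSpace Ω] [TopologicalSpace T]
    (Y : Ω → T → ℝ) (P : Measure Ω) : Prop where
  measurable : ∀ s, Measurable (fun ω => Y ω s)
  nonneg : ∀ ω s, 0 ≤ Y ω s
  continuous : ∀ ω, Continuous (Y ω)
  mean_one : ∀ s, ∫ ω, Y ω s ∂P = 1
  sup_finite : ∫⁻ ω, ⨆ s, ENNReal.ofReal (Y ω s) ∂P < ∞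

/-- The ingredients of the spectral representation: `ζ 0, ζ 1, …` are the points of a Poisson
process on `(0, ∞)` with intensity `z⁻² dz`, and the `Ys i` are independent copies of the process
`Y` with continuous sample paths, independent of the points. Laws of processes are laws on the
product space `T → ℝ`, i.e. they are given by the finite-dimensional distributions. -/
structure IsSpectralRepresentation {Ω Ω' T : Type*} [MeasurableSpace Ω] [MeasurableSpace Ω']
    [TopologicalSpace T] (ζ : ℕ → Ω → ℝ) (Ys : ℕ → Ω → T → ℝ) (P : Measure Ω)
    (Y : Ω' → T → ℝ) (P' : Measure Ω') : Prop where
  poisson : IsPoissonProcess ζ inverseSquareMeasure P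
  spectral : ∀ i, IsSpectralProcess (Ys i) P
  identDistrib : ∀ i, IdentDistrib (Ys i) Y P P'
  iIndep : iIndepFun Ys P
  indep : IndepFun (fun ω i => ζ i ω) (fun ω i => Ys i ω) P

/-- The random functions `φ_i(s) = ζ_i Y_i(s)`. -/
def spectralFunction {Ω T : Type*} (ζ : ℕ → Ω → ℝ) (Ys : ℕ → Ω → T → ℝ) (i : ℕ) (ω : Ω)
    (s : T) : ℝ :=
  ζ i ω * Ys i ω s

/-- The max-stable process `η(s) = max_i ζ_i Y_i(s)`. It is defined as a supremum in the extended
reals, so that it means the right thing for every outcome. -/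
def maxStable {Ω T : Type*} (ζ : ℕ → Ω → ℝ) (Ys : ℕ → Ω → T → ℝ) (ω : Ω) (s : T) : EReal :=
  ⨆ i, (spectralFunction ζ Ys i ω s : EReal)

/-- The extremal concurrence probability: the probability that one single function `φ_ℓ` attains
the maximum `η` at all the points `s_1, …, s_k`. -/
def extremalConcurrenceProb {Ω T : Type*} [MeasurableSpace Ω] (ζ : ℕ → Ω → ℝ)
    (Ys : ℕ → Ω → T → ℝ) (P : Measure Ω) {k : ℕ} (s : Fin k → T) : ℝ≥0∞ :=
  P {ω | ∃ l : ℕ, ∀ j, maxStable ζ Ys ω (s j) = (spectralFunction ζ Ys l ω (s j) : EReal)}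

end Concurrence

end

/-! Call an index ℓ dominating if φ_ℓ ≥ φ_i at s_1, …, s_k for every i ≠ ℓ; concurrence means that
such an index exists. Its probability is at most the expected number of weakly dominating indices,
and at least the expected number of strictly dominating ones, since the strict events are disjoint.
Both expectations equal the right-hand side, essentially because z⁻² dz has no atoms, so ties need
no separate treatment (`measure_iUnion_dominating_le`).

To compute such an expectation (`tsum_measure_dominating`), fix the mark v of the candidate ℓ. Given
the points, the other marks are independent, so ℓ dominates with probability ∏_{i≠ℓ} G(ζ_i/ζ_ℓ),
where G(t) is the probability that t times a fresh mark is dominated by v. Summing over ℓ, the Mecke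
formula and the homogeneity of the intensity give ∫ exp(-c/z) z⁻² dz = 1/c with c = ∫ (1 - G(x)) x⁻²
dx (`lintegral_tsum_tprod_div`). Tonelli turns c into the mean of max_j u_j/v_j over a fresh mark u.

The Mecke formula is derived from counts alone, for a product of values g(ζ_i) with g equal to a
constant a on a set B (`lintegral_tsum_indicator_mul_tprod`): the count N in B satisfies E[N
a^(N-1)] = μ(B) exp(-μ(B)(1-a)) and is independent of the counts off B. The integrand G(ζ_i/ζ_ℓ) is
then squeezed between functions of this kind on the cells (r^m, r^(m+1)], and r decreases to 1. -/

namespace Concurrence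

/-! ### The function `x ↦ exp (-x)` on `[0, ∞]` -/

/-- The function `x ↦ exp (-x)` on `[0, ∞]`, with `exp (-∞) = 0`. -/
noncomputable def expNeg (x : ℝ≥0∞) : ℝ≥0∞ := EReal.exp (-(x : EReal))

lemma expNeg_zero : expNeg 0 = 1 := by simp [expNeg]

lemma expNeg_top : expNeg ∞ = 0 := by simp [expNeg]

lemma expNeg_ofReal {x : ℝ} (hx : 0 ≤ x) :
    expNeg (ENNReal.ofReal x) = ENNReal.ofReal (Real.exp (-x)) := by
  rw [expNeg, EReal.coe_ennreal_ofReal, max_eq_left hx, ← EReal.coe_neg, EReal.exp_coe]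

lemma expNeg_antitone : Antitone expNeg := fun x y h => by
  simpa [expNeg, EReal.exp_le_exp_iff] using h

lemma expNeg_le_one (x : ℝ≥0∞) : expNeg x ≤ 1 :=
  expNeg_zero ▸ expNeg_antitone zero_le

lemma continuous_expNeg : Continuous expNeg :=
  ENNReal.continuous_exp.comp (continuous_neg.comp continuous_coe_ennreal_ereal)

lemma measurable_expNeg : Measurable expNeg := continuous_expNeg.measurable

lemma expNeg_add (x y : ℝ≥0∞) : expNeg (x + y) = expNeg x * expNeg y := by
  have hx : -(x : EReal) ≠ ⊤ := by simp [EReal.neg_eq_top_iff]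
  rw [expNeg, EReal.coe_ennreal_add, EReal.neg_add (by simp) (by simp), sub_eq_add_neg,
    EReal.exp_add, expNeg, expNeg]

lemma expNeg_sum {ι : Type*} (s : Finset ι) (f : ι → ℝ≥0∞) :
    expNeg (∑ i ∈ s, f i) = ∏ i ∈ s, expNeg (f i) := by
  classical
  induction s using Finset.induction_on with
  | empty => simp [expNeg_zero]
  | insert i s hi ih => rw [Finset.sum_insert hi, Finset.prod_insert hi, expNeg_add, ih]

lemma expNeg_tsum {ι : Type*} (f : ι → ℝ≥0∞) :
    expNeg (∑' i, f i) = ∏' i, expNeg (f i) := by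
  have h : HasProd (fun i => expNeg (f i)) (expNeg (∑' i, f i)) := by
    have := (continuous_expNeg.tendsto _).comp (ENNReal.summable (f := f)).hasSum
    simpa only [HasProd, Function.comp_def, expNeg_sum] using this
  exact h.tprod_eq.symm

lemma expNeg_nat_mul (n : ℕ) (x : ℝ≥0∞) : expNeg (n * x) = expNeg x ^ n := by
  simpa using expNeg_sum (Finset.range n) (fun _ => x)

/-- The inverse of `expNeg` on `[0, 1]`. -/
noncomputable def negLog (x : ℝ≥0∞) : ℝ≥0∞ := (-ENNReal.log x).toENNReal

lemma expNeg_negLog {x : ℝ≥0∞} (hx : x ≤ 1) : expNeg (negLog x) = x := by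
  rw [expNeg, negLog, EReal.coe_toENNReal, neg_neg, ENNReal.exp_log]
  simpa [EReal.neg_nonneg] using hx

lemma measurable_negLog : Measurable negLog :=
  measurable_ereal_toENNReal.comp (continuous_neg.measurable.comp ENNReal.measurable_log)

/-- Turns infinite products into sums in [0, ∞], which always converge; a zero factor is allowed and
becomes an infinite summand. -/
lemma tprod_eq_expNeg_tsum_negLog {ι : Type*} {f : ι → ℝ≥0∞} (hf : ∀ i, f i ≤ 1) :
    ∏' i, f i = expNeg (∑' i, negLog (f i)) := by
  rw [expNeg_tsum]
  exact tprod_congr fun i => (expNeg_negLog (hf i)).symm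

lemma tprod_mono_of_le_one {ι : Type*} {f g : ι → ℝ≥0∞} (h : ∀ i, f i ≤ g i)
    (hg : ∀ i, g i ≤ 1) : ∏' i, f i ≤ ∏' i, g i := by
  rw [ENNReal.tprod_eq_iInf_prod hg, ENNReal.tprod_eq_iInf_prod fun i => (h i).trans (hg i)]
  exact iInf_mono fun s => Finset.prod_le_prod' fun i _ => h i

lemma measurable_tprod_of_le_one {ι α : Type*} [Countable ι] [MeasurableSpace α]
    {f : ι → α → ℝ≥0∞} (hf : ∀ i, Measurable (f i)) (h : ∀ i a, f i a ≤ 1) :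
    Measurable fun a => ∏' i, f i a := by
  simp_rw [fun a => tprod_eq_expNeg_tsum_negLog fun i => h i a]
  exact measurable_expNeg.comp (Measurable.tsum fun i => measurable_negLog.comp (hf i))

/-! ### The measure `z⁻² dz` -/

lemma inverseSquareMeasure_Iic : inverseSquareMeasure (Set.Iic 0) = 0 := by
  rw [inverseSquareMeasure, withDensity_apply _ measurableSet_Iic,
    Measure.restrict_restrict measurableSet_Iic, Set.Iic_inter_Ioi, Set.Ioc_self,
    Measure.restrict_empty, lintegral_zero_measure]

lemma ae_pos_inverseSquareMeasure : ∀ᵐ z ∂inverseSquareMeasure, 0 < z := by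
  rw [ae_iff]
  refine measure_mono_null (fun z hz => ?_) inverseSquareMeasure_Iic
  exact not_lt.1 hz

lemma lintegral_inverseSquareMeasure {f : ℝ → ℝ≥0∞} (hf : Measurable f) :
    ∫⁻ z, f z ∂inverseSquareMeasure =
      ∫⁻ z in Set.Ioi 0, ENNReal.ofReal ((z ^ 2)⁻¹) * f z := by
  rw [inverseSquareMeasure, lintegral_withDensity_eq_lintegral_mul _ (by fun_prop) hf]
  rfl

instance : SFinite inverseSquareMeasure := by
  unfold inverseSquareMeasure; infer_instance

instance : NullSingletonClass inverseSquareMeasure :=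
  ⟨fun x => withDensity_absolutelyContinuous _ _ (measure_singleton x)⟩

lemma lintegral_expNeg_div_ofReal {c : ℝ} (hc : 0 < c) :
    ∫⁻ z, expNeg (ENNReal.ofReal c / ENNReal.ofReal z) ∂inverseSquareMeasure =
      (ENNReal.ofReal c)⁻¹ := by
  have hm : Measurable fun z => expNeg (ENNReal.ofReal c / ENNReal.ofReal z) :=
    measurable_expNeg.comp (by fun_prop)
  rw [lintegral_inverseSquareMeasure hm]
  -- An antiderivative of z⁻² exp(-c/z). The value 0 at z = 0 is imposed by hand: the convention
  -- -c/0 = 0 would give 1/c there and destroy right continuity.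
  let g : ℝ → ℝ := fun z => if z ≤ 0 then 0 else Real.exp (-c / z) / c
  let g' : ℝ → ℝ := fun z => (z ^ 2)⁻¹ * Real.exp (-c / z)
  have hg0 : g 0 = 0 := by simp [g]
  have hpos : ∀ z ∈ Set.Ioi (0 : ℝ), g z = Real.exp (-c / z) / c := fun z hz => by
    simp [g, not_le.2 (Set.mem_Ioi.1 hz)]
  have hcont : ContinuousWithinAt g (Set.Ici 0) 0 := by
    rw [← continuousWithinAt_Ioi_iff_Ici, ContinuousWithinAt, hg0]
    have h1 : Filter.Tendsto (fun z : ℝ => -c / z) (nhdsWithin 0 (Set.Ioi 0)) Filter.atBot := by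
      simp_rw [div_eq_mul_inv]
      exact Filter.Tendsto.const_mul_atTop_of_neg (by linarith) tendsto_inv_nhdsGT_zero
    have h2 := (Real.tendsto_exp_atBot.comp h1).div_const c
    rw [zero_div] at h2
    refine h2.congr' ?_
    filter_upwards [self_mem_nhdsWithin] with z hz
    exact (hpos z hz).symm
  have hderiv : ∀ z ∈ Set.Ioi (0 : ℝ), HasDerivAt g (g' z) z := by
    intro z hz
    have hz' : z ≠ 0 := (Set.mem_Ioi.1 hz).ne'
    have h1 : HasDerivAt (fun z => Real.exp (-c / z) / c) (g' z) z := by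
      have h2 : HasDerivAt (fun z => Real.exp (-c / z) / c)
          (Real.exp (-c / z) * ((0 * z - -c * 1) / z ^ 2) / c) z :=
        (((hasDerivAt_const z (-c)).div (hasDerivAt_id z) hz').exp).div_const c
      refine h2.congr_deriv ?_
      simp only [g']
      field_simp
      ring
    refine h1.congr_of_eventuallyEq ?_
    filter_upwards [Ioi_mem_nhds hz] with y hy using hpos y hy
  have hnn : ∀ z ∈ Set.Ioi (0 : ℝ), 0 ≤ g' z := fun z _ => by positivity
  have hlim : Filter.Tendsto g Filter.atTop (nhds (1 / c)) := by
    have h1 : Filter.Tendsto (fun z : ℝ => Real.exp (-c / z) / c) Filter.atTop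
        (nhds (Real.exp 0 / c)) :=
      ((Real.continuous_exp.tendsto 0).comp
        (tendsto_const_nhds.div_atTop Filter.tendsto_id)).div_const c
    rw [Real.exp_zero] at h1
    refine h1.congr' ?_
    filter_upwards [Filter.Ioi_mem_atTop 0] with y hy using (hpos y hy).symm
  have hint := integrableOn_Ioi_deriv_of_nonneg hcont hderiv hnn hlim
  have hval := integral_Ioi_of_hasDerivAt_of_nonneg hcont hderiv hnn hlim
  calc ∫⁻ z in Set.Ioi 0, ENNReal.ofReal ((z ^ 2)⁻¹) *
        expNeg (ENNReal.ofReal c / ENNReal.ofReal z)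
      = ∫⁻ z in Set.Ioi 0, ENNReal.ofReal (g' z) := by
        refine setLIntegral_congr_fun measurableSet_Ioi fun z hz => ?_
        have hz' : 0 < z := hz
        simp only [g']
        rw [← ENNReal.ofReal_div_of_pos hz', expNeg_ofReal (by positivity),
          ENNReal.ofReal_mul (by positivity), neg_div]
    _ = ENNReal.ofReal (∫ z in Set.Ioi 0, g' z) :=
        (ofReal_integral_eq_lintegral_ofReal hint
          ((ae_restrict_iff' measurableSet_Ioi).2 (Filter.Eventually.of_forall hnn))).symm
    _ = (ENNReal.ofReal c)⁻¹ := by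
        rw [hval, hg0, sub_zero, one_div, ENNReal.ofReal_inv_of_pos hc]

lemma inverseSquareMeasure_Ioi_of_pos {a : ℝ} (ha : 0 < a) :
    inverseSquareMeasure (Set.Ioi a) = (ENNReal.ofReal a)⁻¹ := by
  have h := integral_Ioi_rpow_of_lt (a := -2) (by norm_num) ha
  have hint := integrableOn_Ioi_rpow_of_lt (a := -2) (by norm_num) ha
  have hrw : ∀ z ∈ Set.Ioi a, z ^ (-2 : ℝ) = (z ^ 2)⁻¹ := fun z hz => by
    rw [Real.rpow_neg (ha.trans hz).le]; norm_num
  rw [inverseSquareMeasure, withDensity_apply _ measurableSet_Ioi,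
    Measure.restrict_restrict measurableSet_Ioi,
    Set.inter_eq_left.2 (Set.Ioi_subset_Ioi ha.le)]
  rw [← ofReal_integral_eq_lintegral_ofReal, ← setIntegral_congr_fun measurableSet_Ioi hrw, h,
    ← ENNReal.ofReal_inv_of_pos ha]
  · congr 1
    norm_num [Real.rpow_neg ha.le]
  · exact (integrableOn_congr_fun hrw measurableSet_Ioi).1 hint
  · exact Filter.Eventually.of_forall fun z => by positivity

lemma inverseSquareMeasure_Ioi_zero : inverseSquareMeasure (Set.Ioi 0) = ∞ := by
  refine ENNReal.eq_top_of_forall_nnreal_le fun r => ?_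
  have hr : (0 : ℝ) < (r + 1 : ℝ)⁻¹ := by positivity
  calc (r : ℝ≥0∞) ≤ (ENNReal.ofReal (r + 1 : ℝ)⁻¹)⁻¹ := by
        rw [ENNReal.ofReal_inv_of_pos (by positivity), inv_inv, ← ENNReal.ofReal_coe_nnreal]
        exact ENNReal.ofReal_le_ofReal (by linarith)
    _ = _ := (inverseSquareMeasure_Ioi_of_pos hr).symm
    _ ≤ _ := measure_mono (Set.Ioi_subset_Ioi hr.le)

/-- The source of the quotients in the theorem. The conventions 0/0 = 0 and a/0 = ∞ are exactly what
the empty set and the infinite mass of (0, ∞) require. -/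
lemma inverseSquareMeasure_lt_mul {a b : ℝ} (ha : 0 ≤ a) (hb : 0 ≤ b) :
    inverseSquareMeasure {x | b < x * a} = ENNReal.ofReal a / ENNReal.ofReal b := by
  rcases ha.eq_or_lt with rfl | ha
  · simp [not_lt.2 hb]
  have hset : {x | b < x * a} = Set.Ioi (b / a) := by
    ext x; simp [div_lt_iff₀ ha]
  rw [hset]
  rcases hb.eq_or_lt with rfl | hb
  · rw [zero_div, inverseSquareMeasure_Ioi_zero, ENNReal.ofReal_zero,
      ENNReal.div_zero (by simpa using ha)]
  · rw [inverseSquareMeasure_Ioi_of_pos (by positivity), ENNReal.ofReal_div_of_pos ha,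
      ENNReal.inv_div (by simp) (by simp [ha])]

/-- The endpoint b/a carries no mass. For a = b = 0 the set would be the whole line, of infinite
mass, against 0/0 = 0; hence b > 0. -/
lemma inverseSquareMeasure_le_mul {a b : ℝ} (ha : 0 ≤ a) (hb : 0 < b) :
    inverseSquareMeasure {x | b ≤ x * a} = ENNReal.ofReal a / ENNReal.ofReal b := by
  rw [← inverseSquareMeasure_lt_mul ha hb.le]
  rcases ha.eq_or_lt with rfl | ha
  · simp [not_le.2 hb, not_lt.2 hb.le]
  have h1 : {x | b ≤ x * a} = Set.Ici (b / a) := by ext x; simp [div_le_iff₀ ha]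
  have h2 : {x | b < x * a} = Set.Ioi (b / a) := by ext x; simp [div_lt_iff₀ ha]
  rw [h1, h2, measure_congr Ioi_ae_eq_Ici]

lemma lintegral_comp_div_inverseSquareMeasure {f : ℝ → ℝ≥0∞} (hf : Measurable f) {z : ℝ}
    (hz : 0 < z) :
    ∫⁻ x, f (x / z) ∂inverseSquareMeasure =
      (∫⁻ x, f x ∂inverseSquareMeasure) / ENNReal.ofReal z := by
  have hzi : 0 < z⁻¹ := inv_pos.2 hz
  rw [lintegral_inverseSquareMeasure hf,
    lintegral_inverseSquareMeasure (f := fun x => f (x / z))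
      (hf.comp (measurable_id.div_const z)),
    ← lintegral_indicator measurableSet_Ioi, ← lintegral_indicator measurableSet_Ioi]
  set F : ℝ → ℝ≥0∞ := (Set.Ioi 0).indicator fun z => ENNReal.ofReal ((z ^ 2)⁻¹) * f z with hF
  have hFm : Measurable F := Measurable.indicator (by fun_prop) measurableSet_Ioi
  have h1 : ∀ x, (Set.Ioi 0).indicator (fun x => ENNReal.ofReal ((x ^ 2)⁻¹) * f (x / z)) x =
      ENNReal.ofReal ((z ^ 2)⁻¹) * F (z⁻¹ * x) := by
    intro x
    by_cases hx : 0 < x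
    · have hx' : 0 < z⁻¹ * x := by positivity
      rw [hF, Set.indicator_of_mem (Set.mem_Ioi.2 hx), Set.indicator_of_mem (Set.mem_Ioi.2 hx'),
        ← mul_assoc, ← ENNReal.ofReal_mul (by positivity)]
      congr 2
      · field_simp
      · field_simp
    · have hx' : ¬ 0 < z⁻¹ * x := by
        rw [mul_pos_iff_of_pos_left hzi]; exact hx
      rw [hF, Set.indicator_of_notMem (by simpa using hx),
        Set.indicator_of_notMem (by simpa only [Set.mem_Ioi] using hx'), mul_zero]
  simp_rw [h1]
  rw [lintegral_const_mul (f := fun x => F (z⁻¹ * x)) _ (hFm.comp (measurable_const_mul _)),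
    ← lintegral_map hFm (measurable_const_mul _), Real.map_volume_mul_left hzi.ne',
    lintegral_smul_measure, inv_inv, abs_of_pos hz, smul_eq_mul, ← mul_assoc,
    ← ENNReal.ofReal_mul (by positivity), mul_comm, div_eq_mul_inv,
    ← ENNReal.ofReal_inv_of_pos hz]
  congr 2
  field_simp

lemma lintegral_expNeg_div {c : ℝ≥0∞} (hc : c ≠ 0) :
    ∫⁻ z, expNeg (c / ENNReal.ofReal z) ∂inverseSquareMeasure = c⁻¹ := by
  rcases eq_or_ne c ∞ with rfl | hc'
  · simp [ENNReal.top_div, expNeg_top]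
  · have h := lintegral_expNeg_div_ofReal (ENNReal.toReal_pos hc hc')
    rwa [ENNReal.ofReal_toReal hc'] at h

end Concurrence

namespace Concurrence

/-! ### Counts of a Poisson process -/

lemma tsum_indicator_const_eq_pointCount_mul {Ω E : Type*} (ζ : ℕ → Ω → E) (A : Set E)
    (c : ℝ≥0∞) (ω : Ω) :
    ∑' i, A.indicator (fun _ => c) (ζ i ω) = (pointCount ζ A ω : ℝ≥0∞) * c := by
  rw [pointCount, ← ENNReal.tsum_set_const, tsum_subtype {i : ℕ | ζ i ω ∈ A} (fun _ => c)]
  rfl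

lemma measurable_pointCount {Ω E : Type*} [MeasurableSpace Ω] [MeasurableSpace E]
    {ζ : ℕ → Ω → E} (hζ : ∀ i, Measurable (ζ i)) {A : Set E} (hA : MeasurableSet A) :
    Measurable (pointCount ζ A) := by
  refine measurable_encard.comp (measurable_set_iff.2 fun i => ?_)
  exact (measurable_mem (α := E) (s := A) |>.2 hA).comp (hζ i)

lemma lintegral_finset_prod_of_iIndepFun {Ω ι : Type*} [MeasurableSpace Ω] {P : Measure Ω}
    [IsProbabilityMeasure P] {X : ι → Ω → ℝ≥0∞} (hX : iIndepFun X P)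
    (hm : ∀ i, Measurable (X i)) (s : Finset ι) :
    ∫⁻ ω, ∏ i ∈ s, X i ω ∂P = ∏ i ∈ s, ∫⁻ ω, X i ω ∂P := by
  classical
  induction s using Finset.induction_on with
  | empty => simp
  | insert i s hi ih =>
    have h := lintegral_mul_eq_lintegral_mul_lintegral_of_indepFun
      (f := ∏ j ∈ s, X j) (by fun_prop) (hm i) (hX.indepFun_finsetProd_of_notMem hm hi)
    simp only [Pi.mul_apply, Finset.prod_apply] at h
    simp_rw [Finset.prod_insert hi, mul_comm (X i _)]
    rw [h, ih, mul_comm]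

/-- The generating function of the Poisson distribution. -/
lemma tsum_poissonMeasure_mul_pow (r : NNReal) {x : ℝ≥0∞} (hx : x ≤ 1) :
    ∑' n : ℕ, poissonMeasure r {n} * x ^ n = expNeg (r * (1 - x)) := by
  have hx' : x ≠ ∞ := (hx.trans_lt ENNReal.one_lt_top).ne
  lift x to NNReal using hx'
  have hx1 : x ≤ 1 := by exact_mod_cast hx
  have hs : HasSum (fun n : ℕ => Real.exp (-r) * (r * x : ℝ) ^ n / n.factorial)
      (Real.exp (-((r : ℝ) * (1 - (x : ℝ))))) := by
    have := (NormedSpace.expSeries_div_hasSum_exp (r * x : ℝ)).mul_left (Real.exp (-r))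
    rw [← Real.exp_eq_exp_ℝ, ← Real.exp_add] at this
    rw [mul_sub, mul_one, neg_sub, sub_eq_neg_add]
    refine this.congr_fun fun n => ?_
    exact mul_div_assoc _ _ _
  have hr : (r * (1 - x) : ℝ≥0∞) = ENNReal.ofReal ((r : ℝ) * (1 - (x : ℝ))) := by
    rw [ENNReal.ofReal_mul (by positivity), ENNReal.ofReal_sub _ (by positivity)]
    simp
  rw [hr, expNeg_ofReal (mul_nonneg r.coe_nonneg (sub_nonneg.2 (by exact_mod_cast hx1))), ← hs.tsum_eq,
    ENNReal.ofReal_tsum_of_nonneg (fun n => by positivity) hs.summable]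
  refine tsum_congr fun n => ?_
  rw [poissonMeasure_singleton, ← ENNReal.ofReal_coe_nnreal (p := x),
    ← ENNReal.ofReal_pow (by positivity), ← ENNReal.ofReal_mul (by positivity)]
  congr 1
  rw [mul_pow]; ring

/-- The derivative of the generating function of the Poisson distribution. -/
lemma tsum_poissonMeasure_mul_mul_pow (r : NNReal) {x : ℝ≥0∞} (hx : x ≤ 1) :
    ∑' n : ℕ, poissonMeasure r {n} * (n * x ^ (n - 1)) = r * expNeg (r * (1 - x)) := by
  rw [tsum_eq_zero_add' ENNReal.summable, ← tsum_poissonMeasure_mul_pow r hx,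
    ← ENNReal.tsum_mul_left]
  simp only [Nat.cast_zero, zero_mul, mul_zero, zero_add, Nat.add_sub_cancel, ← mul_assoc]
  refine tsum_congr fun n => ?_
  congr 1
  rw [poissonMeasure_singleton, poissonMeasure_singleton, ← ENNReal.ofReal_natCast,
    ← ENNReal.ofReal_coe_nnreal (p := r), ← ENNReal.ofReal_mul (by positivity),
    ← ENNReal.ofReal_mul (by positivity)]
  congr 1
  rw [Nat.factorial_succ]
  push_cast
  field_simp
  exact pow_succ' _ _

lemma IsPoissonProcess.iIndepFun_pointCount {Ω E : Type*} [MeasurableSpace Ω]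
    [MeasurableSpace E] {ζ : ℕ → Ω → E} {μ : Measure E} {P : Measure Ω}
    (h : IsPoissonProcess ζ μ P) {ι : Type*} [Finite ι] {A : ι → Set E}
    (hA : ∀ i, MeasurableSet (A i)) (hd : Pairwise (Function.onFun Disjoint A)) :
    iIndepFun (fun i => pointCount ζ (A i)) P := by
  obtain ⟨n, ⟨e⟩⟩ := Finite.exists_equiv_fin ι
  have h1 := h.indep n (fun i => A (e.symm i)) (fun i => hA _)
    (fun i j hij => hd (e.symm.injective.ne hij))
  have h2 := h1.precomp e.injective
  simpa using h2

namespace IsPoissonProcess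

variable {Ω E : Type*} [MeasurableSpace Ω] [MeasurableSpace E] {ζ : ℕ → Ω → E} {μ : Measure E}
  {P : Measure Ω} [IsProbabilityMeasure P]

lemma map_pointCount (h : IsPoissonProcess ζ μ P) {A : Set E} (hA : MeasurableSet A)
    (hfin : μ A ≠ ∞) :
    P.map (pointCount ζ A) = (poissonMeasure (μ A).toNNReal).map (Nat.cast : ℕ → ℕ∞) := by
  have hN := measurable_pointCount h.measurable hA
  have hc : Measurable (Nat.cast : ℕ → ℕ∞) := Measurable.of_discrete
  have hP := Measure.isProbabilityMeasure_map (μ := P) hN.aemeasurable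
  have hQ := Measure.isProbabilityMeasure_map (μ := poissonMeasure (μ A).toNNReal) hc.aemeasurable
  have hnat : ∀ n : ℕ, P.map (pointCount ζ A) {(n : ℕ∞)} =
      (poissonMeasure (μ A).toNNReal).map (Nat.cast : ℕ → ℕ∞) {(n : ℕ∞)} := by
    intro n
    rw [Measure.map_apply hN (measurableSet_singleton _),
      Measure.map_apply hc (measurableSet_singleton _)]
    have : (Nat.cast : ℕ → ℕ∞) ⁻¹' {(n : ℕ∞)} = {n} := by ext; simp
    rw [this]
    exact h.poisson A hA hfin n
  -- The mass at ⊤ follows from the finite counts because both laws have total mass one.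
  have htop : ({⊤} : Set ℕ∞) = (⋃ n : ℕ, {(n : ℕ∞)})ᶜ := by
    ext x
    induction x using ENat.recTopCoe <;> simp
  have hdisj : Pairwise (Function.onFun Disjoint fun n : ℕ => ({(n : ℕ∞)} : Set ℕ∞)) := by
    intro m n hmn
    simpa [Function.onFun] using hmn
  refine Measure.ext_of_singleton fun x => ?_
  induction x using ENat.recTopCoe with
  | coe n => exact hnat n
  | top =>
    rw [htop, prob_compl_eq_one_sub (MeasurableSet.of_discrete),
      prob_compl_eq_one_sub (MeasurableSet.of_discrete),
      measure_iUnion hdisj (fun _ => measurableSet_singleton _),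
      measure_iUnion hdisj (fun _ => measurableSet_singleton _)]
    simp_rw [hnat]

lemma lintegral_pointCount (h : IsPoissonProcess ζ μ P) {A : Set E} (hA : MeasurableSet A)
    (hfin : μ A ≠ ∞) (Φ : ℕ∞ → ℝ≥0∞) :
    ∫⁻ ω, Φ (pointCount ζ A ω) ∂P = ∑' n : ℕ, poissonMeasure (μ A).toNNReal {n} * Φ n := by
  rw [← lintegral_map (Measurable.of_discrete (f := Φ)) (measurable_pointCount h.measurable hA),
    h.map_pointCount hA hfin,
    lintegral_map (Measurable.of_discrete (f := Φ)) Measurable.of_discrete, lintegral_countable']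
  exact tsum_congr fun n => mul_comm _ _

lemma ae_pointCount_ne_top (h : IsPoissonProcess ζ μ P) {A : Set E} (hA : MeasurableSet A)
    (hfin : μ A ≠ ∞) : ∀ᵐ ω ∂P, pointCount ζ A ω ≠ ⊤ := by
  have h0 : ∀ᵐ x ∂(P.map (pointCount ζ A)), x ≠ ⊤ := by
    rw [h.map_pointCount hA hfin, ae_map_iff Measurable.of_discrete.aemeasurable
      MeasurableSet.of_discrete]
    simp
  exact ae_of_ae_map (measurable_pointCount h.measurable hA).aemeasurable h0

lemma lintegral_expNeg_mul_pointCount (h : IsPoissonProcess ζ μ P) {A : Set E}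
    (hA : MeasurableSet A) (a : ℝ≥0∞) :
    ∫⁻ ω, expNeg (pointCount ζ A ω * a) ∂P = expNeg (μ A * (1 - expNeg a)) := by
  -- If μ A = ∞ the count is almost surely ⊤, and both sides are 1 for a = 0 (as ∞ · 0 = 0) and 0
  -- otherwise.
  by_cases hfin : μ A = ∞
  · have hae := h.infinite A hA hfin
    rw [lintegral_congr_ae (g := fun _ => expNeg (∞ * a))
      (hae.mono fun ω hω => by simp only [hω, ENat.toENNReal_top])]
    rw [lintegral_const, measure_univ, mul_one, hfin]
    rcases eq_or_ne a 0 with rfl | ha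
    · simp [expNeg_zero]
    · have h1 : expNeg a < 1 := by
        rw [expNeg, EReal.exp_lt_one_iff, EReal.neg_lt_zero]
        simpa [pos_iff_ne_zero] using ha
      rw [ENNReal.top_mul ha, ENNReal.top_mul (tsub_pos_of_lt h1).ne']
  · rw [h.lintegral_pointCount hA hfin fun n => expNeg (n * a)]
    simp_rw [ENat.toENNReal_coe, expNeg_nat_mul]
    rw [tsum_poissonMeasure_mul_pow _ (expNeg_le_one a), ENNReal.coe_toNNReal hfin]

/-- N - 1 counts the points left after one of the N has been singled out. Truncated subtraction at N
= 0 is harmless because of the factor N. -/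
lemma lintegral_pointCount_mul_expNeg (h : IsPoissonProcess ζ μ P) {A : Set E}
    (hA : MeasurableSet A) (hfin : μ A ≠ ∞) (a : ℝ≥0∞) :
    ∫⁻ ω, pointCount ζ A ω * expNeg ((pointCount ζ A ω - 1 : ℕ∞) * a) ∂P =
      μ A * expNeg (μ A * (1 - expNeg a)) := by
  rw [h.lintegral_pointCount hA hfin fun n => n * expNeg ((n - 1 : ℕ∞) * a)]
  have : ∀ n : ℕ, (((n : ℕ∞) - 1 : ℕ∞) : ℝ≥0∞) = ((n - 1 : ℕ) : ℝ≥0∞) := fun n => by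
    rw [← ENat.toENNReal_coe]; norm_cast
  simp_rw [ENat.toENNReal_coe, this, expNeg_nat_mul]
  rw [tsum_poissonMeasure_mul_mul_pow _ (expNeg_le_one a), ENNReal.coe_toNNReal hfin]

end IsPoissonProcess

end Concurrence

namespace Concurrence

/-! ### A Mecke formula for products -/

lemma indicator_compl_comp_simpleFunc {E : Type*} [MeasurableSpace E] (f : SimpleFunc E ℝ≥0∞)
    (B : Set E) (F : ℝ≥0∞ → ℝ≥0∞) (x : E) :
    Bᶜ.indicator (fun x => F (f x)) x =
      ∑ a : f.range, (f ⁻¹' {(a : ℝ≥0∞)} \ B).indicator (fun _ => F a) x := by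
  classical
  by_cases hx : x ∈ B
  · simp [hx]
  · rw [Finset.sum_eq_single (⟨f x, f.mem_range_self x⟩ : f.range)]
    · simp [hx]
    · intro a _ ha
      refine Set.indicator_of_notMem (fun h => ha ?_) _
      exact Subtype.ext (by simpa using h.1.symm)
    · simp

namespace IsPoissonProcess

variable {Ω E : Type*} [MeasurableSpace Ω] [MeasurableSpace E] {ζ : ℕ → Ω → E} {μ : Measure E}
  {P : Measure Ω} [IsProbabilityMeasure P]

/-- B and the level sets of `f` off B are finitely many disjoint sets, so their counts are
independent and the mean factorises. In `Option f.range`, `none` stands for B. -/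
lemma lintegral_mul_expNeg_tsum_simpleFunc (h : IsPoissonProcess ζ μ P) {B : Set E}
    (hB : MeasurableSet B) (Φ : ℕ∞ → ℝ≥0∞) (f : SimpleFunc E ℝ≥0∞) :
    ∫⁻ ω, Φ (pointCount ζ B ω) * expNeg (∑' i, Bᶜ.indicator f (ζ i ω)) ∂P =
      (∫⁻ ω, Φ (pointCount ζ B ω) ∂P) * expNeg (∫⁻ x in Bᶜ, (1 - expNeg (f x)) ∂μ) := by
  let A : Option f.range → Set E := fun o => o.elim B fun a => f ⁻¹' {(a : ℝ≥0∞)} \ B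
  have hA : ∀ o, MeasurableSet (A o) := by
    rintro (_ | a)
    · exact hB
    · exact (f.measurableSet_fiber _).diff hB
  have hd : Pairwise (Function.onFun Disjoint A) := by
    rintro (_ | a) (_ | b) hab
    · exact absurd rfl hab
    · exact Set.disjoint_sdiff_right
    · exact Set.disjoint_sdiff_left
    · refine Set.disjoint_left.2 fun x hx hx' => hab ?_
      have h1 : f x = a := hx.1
      have h2 : f x = b := hx'.1
      rw [Subtype.ext (h1.symm.trans h2)]
  have hN : ∀ o, Measurable (pointCount ζ (A o)) := fun o =>
    measurable_pointCount h.measurable (hA o)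
  let g : Option f.range → ℕ∞ → ℝ≥0∞ := fun o n => o.elim (Φ n) fun a => expNeg (n * (a : ℝ≥0∞))
  have hind : iIndepFun (fun o ω => g o (pointCount ζ (A o) ω)) P :=
    (h.iIndepFun_pointCount hA hd).comp g fun _ => Measurable.of_discrete
  have hprod := lintegral_finset_prod_of_iIndepFun hind
    (fun o => (Measurable.of_discrete (f := g o)).comp (hN o)) Finset.univ
  simp only [Fintype.prod_option] at hprod
  have hsum : ∀ ω, ∑' i, Bᶜ.indicator f (ζ i ω) =
      ∑ a : f.range, pointCount ζ (A (some a)) ω * (a : ℝ≥0∞) := by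
    intro ω
    simp_rw [← tsum_indicator_const_eq_pointCount_mul]
    rw [← Summable.tsum_finsetSum fun _ _ => ENNReal.summable]
    exact tsum_congr fun i => indicator_compl_comp_simpleFunc f B id (ζ i ω)
  have hint : ∫⁻ x in Bᶜ, (1 - expNeg (f x)) ∂μ =
      ∑ a : f.range, μ (A (some a)) * (1 - expNeg a) := by
    rw [← lintegral_indicator hB.compl]
    simp_rw [indicator_compl_comp_simpleFunc f B (fun a => 1 - expNeg a)]
    refine (lintegral_finsetSum (f := fun (a : f.range) x => (A (some a)).indicator
      (fun _ => 1 - expNeg a) x) _ fun a _ => measurable_const.indicator (hA (some a))).trans ?_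
    refine Finset.sum_congr rfl fun a _ => ?_
    rw [lintegral_indicator_const (hA (some a)), mul_comm]
  simp_rw [hsum, expNeg_sum]
  rw [hint, expNeg_sum]
  refine hprod.trans ?_
  congr 1
  exact Finset.prod_congr rfl fun a _ => h.lintegral_expNeg_mul_pointCount (hA (some a)) _

/-- Increasing simple approximation of `f`: dominated convergence on the left, with `Φ` of the count
as majorant, and monotone convergence inside the exponent on the right. -/
lemma lintegral_mul_expNeg_tsum (h : IsPoissonProcess ζ μ P) {B : Set E}
    (hB : MeasurableSet B) {Φ : ℕ∞ → ℝ≥0∞} (hΦ : ∫⁻ ω, Φ (pointCount ζ B ω) ∂P ≠ ∞)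
    {f : E → ℝ≥0∞} (hf : Measurable f) :
    ∫⁻ ω, Φ (pointCount ζ B ω) * expNeg (∑' i, Bᶜ.indicator f (ζ i ω)) ∂P =
      (∫⁻ ω, Φ (pointCount ζ B ω) ∂P) * expNeg (∫⁻ x in Bᶜ, (1 - expNeg (f x)) ∂μ) := by
  have hΦm : Measurable fun ω => Φ (pointCount ζ B ω) :=
    (Measurable.of_discrete (f := Φ)).comp (measurable_pointCount h.measurable hB)
  have hmono : ∀ x, Monotone fun n => SimpleFunc.eapprox f n x := fun x m n hmn =>
    SimpleFunc.monotone_eapprox f hmn x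
  have hsumm : ∀ (u : E → ℝ≥0∞), Measurable u →
      Measurable fun ω => ∑' i, Bᶜ.indicator u (ζ i ω) := fun u hu =>
    Measurable.tsum fun i => (hu.indicator hB.compl).comp (h.measurable i)
  have hindm : ∀ y, Monotone fun n => Bᶜ.indicator (SimpleFunc.eapprox f n) y := fun y m n hmn =>
    Set.indicator_le_indicator (hmono y hmn)
  have hsum : ∀ ω, Filter.Tendsto
      (fun n => ∑' i, Bᶜ.indicator (SimpleFunc.eapprox f n) (ζ i ω)) Filter.atTop
      (nhds (∑' i, Bᶜ.indicator f (ζ i ω))) := by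
    intro ω
    simp_rw [← lintegral_count]
    refine lintegral_tendsto_of_tendsto_of_monotone
      (fun n => Measurable.of_discrete.aemeasurable)
      (Filter.Eventually.of_forall fun i => hindm _) (Filter.Eventually.of_forall fun i => ?_)
    by_cases hi : ζ i ω ∈ B
    · simp [hi]
    · simpa [hi] using SimpleFunc.tendsto_eapprox hf (ζ i ω)
  have h1 : Filter.Tendsto (fun n => ∫⁻ ω, Φ (pointCount ζ B ω) *
        expNeg (∑' i, Bᶜ.indicator (SimpleFunc.eapprox f n) (ζ i ω)) ∂P) Filter.atTop
      (nhds (∫⁻ ω, Φ (pointCount ζ B ω) * expNeg (∑' i, Bᶜ.indicator f (ζ i ω)) ∂P)) := by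
    refine tendsto_lintegral_of_dominated_convergence (fun ω => Φ (pointCount ζ B ω))
      (fun n => hΦm.mul (measurable_expNeg.comp (hsumm _ (SimpleFunc.measurable _))))
      (fun n => Filter.Eventually.of_forall fun ω => mul_le_of_le_one_right' (expNeg_le_one _))
      hΦ ?_
    filter_upwards [ae_lt_top hΦm hΦ] with ω hω
    exact ENNReal.Tendsto.const_mul ((continuous_expNeg.tendsto _).comp (hsum ω)) (Or.inr hω.ne)
  have h2 : Filter.Tendsto (fun n => ∫⁻ x in Bᶜ, (1 - expNeg (SimpleFunc.eapprox f n x)) ∂μ)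
      Filter.atTop (nhds (∫⁻ x in Bᶜ, (1 - expNeg (f x)) ∂μ)) := by
    refine lintegral_tendsto_of_tendsto_of_monotone
      (fun n => (measurable_const.sub
        (measurable_expNeg.comp (SimpleFunc.measurable _))).aemeasurable)
      (Filter.Eventually.of_forall fun x m n hmn =>
        tsub_le_tsub_left (expNeg_antitone (hmono x hmn)) 1)
      (Filter.Eventually.of_forall fun x => ?_)
    exact ENNReal.Tendsto.sub tendsto_const_nhds
      ((continuous_expNeg.tendsto _).comp (SimpleFunc.tendsto_eapprox hf x))
      (Or.inl ENNReal.one_ne_top)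
  simp_rw [h.lintegral_mul_expNeg_tsum_simpleFunc hB Φ] at h1
  exact tendsto_nhds_unique h1
    (ENNReal.Tendsto.const_mul ((continuous_expNeg.tendsto _).comp h2) (Or.inr hΦ))

/-- If `g` is constant on a set `B` of finite measure, the sum over the points in `B` of the
product of the values of `g` at all other points has the mean given by the Mecke formula. -/
theorem lintegral_tsum_indicator_mul_tprod (h : IsPoissonProcess ζ μ P) {B : Set E}
    (hB : MeasurableSet B) (hfin : μ B ≠ ∞) {g : E → ℝ≥0∞} (hg : Measurable g)
    (hg1 : ∀ x, g x ≤ 1) {a : ℝ≥0∞} (hga : ∀ x ∈ B, g x = a) :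
    ∫⁻ ω, ∑' l, B.indicator 1 (ζ l ω) * ∏' i, (if i = l then 1 else g (ζ i ω)) ∂P =
      μ B * expNeg (∫⁻ x, (1 - g x) ∂μ) := by
  rcases B.eq_empty_or_nonempty with rfl | ⟨x₀, hx₀⟩
  · simp
  have ha1 : a ≤ 1 := hga x₀ hx₀ ▸ hg1 x₀
  set α := negLog a with hα
  set f : E → ℝ≥0∞ := fun x => negLog (g x) with hf
  have hfm : Measurable f := measurable_negLog.comp hg
  have hef : ∀ x, expNeg (f x) = g x := fun x => expNeg_negLog (hg1 x)
  have hΦint := h.lintegral_pointCount_mul_expNeg hB hfin α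
  have key : ∀ ω, pointCount ζ B ω ≠ ⊤ →
      ∑' l, B.indicator 1 (ζ l ω) * ∏' i, (if i = l then 1 else g (ζ i ω)) =
      (pointCount ζ B ω * expNeg ((pointCount ζ B ω - 1 : ℕ∞) * α)) *
        expNeg (∑' i, Bᶜ.indicator f (ζ i ω)) := by
    intro ω hω
    -- Every point of B contributes the same product: a factor `a` for each of the other N - 1
    -- points in B, times the product over the points off B.
    have hl : ∀ l, B.indicator 1 (ζ l ω) * ∏' i, (if i = l then 1 else g (ζ i ω)) =
        B.indicator (fun _ => expNeg ((pointCount ζ B ω - 1 : ℕ∞) * α) *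
          expNeg (∑' i, Bᶜ.indicator f (ζ i ω))) (ζ l ω) := by
      intro l
      by_cases hlB : ζ l ω ∈ B
      · rw [Set.indicator_of_mem hlB, Set.indicator_of_mem hlB, Pi.one_apply, one_mul,
          ← expNeg_add]
        have h1 : ∀ i, (if i = l then 1 else g (ζ i ω)) =
            expNeg (({j | ζ j ω ∈ B} \ {l}).indicator (fun _ => α) i +
              Bᶜ.indicator f (ζ i ω)) := by
          intro i
          by_cases hil : i = l
          · subst hil
            simp [hlB, expNeg_zero]
          · by_cases hi : ζ i ω ∈ B
            · simp [hil, hi, hα, expNeg_negLog ha1, hga _ hi]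
            · simp [hil, hi, hef]
        simp_rw [h1]
        rw [← expNeg_tsum, ENNReal.tsum_add]
        congr 2
        rw [← tsum_subtype, ENNReal.tsum_set_const]
        congr 2
        exact Set.encard_sdiff_singleton_of_mem hlB
      · rw [Set.indicator_of_notMem hlB, Set.indicator_of_notMem hlB, zero_mul]
    simp_rw [hl]
    rw [tsum_indicator_const_eq_pointCount_mul, mul_assoc]
  rw [lintegral_congr_ae ((h.ae_pointCount_ne_top hB hfin).mono key),
    h.lintegral_mul_expNeg_tsum hB (Φ := fun n => n * expNeg ((n - 1 : ℕ∞) * α)) ?_ hfm, hΦint,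
    mul_assoc, ← expNeg_add]
  · congr 2
    simp_rw [hef]
    refine Eq.trans ?_ (lintegral_add_compl (fun x => 1 - g x) hB)
    congr 1
    rw [setLIntegral_congr_fun (g := fun _ => 1 - a) hB fun x hx => by rw [hga x hx],
      setLIntegral_const, mul_comm, hα, expNeg_negLog ha1]
  · rw [hΦint]
    exact ENNReal.mul_ne_top hfin ((expNeg_le_one _).trans_lt ENNReal.one_lt_top).ne

end IsPoissonProcess

end Concurrence

namespace Concurrence

/-! ### Poisson processes with intensity `z⁻² dz` -/

/-- These cells tile (0, ∞), and two points of the same cell have a quotient between r⁻¹ and r. -/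
lemma disjoint_Ioc_zpow {r : ℝ} (hr : 1 < r) :
    Pairwise (Function.onFun Disjoint fun m : ℤ => Set.Ioc (r ^ m) (r * r ^ m)) := by
  have h := (zpow_right_mono₀ hr.le).pairwise_disjoint_on_Ioc_succ
  have hs : ∀ m : ℤ, r ^ Order.succ m = r * r ^ m := fun m => by
    rw [Order.succ_eq_add_one, zpow_add_one₀ (by positivity), mul_comm]
  simpa only [hs] using h

lemma exists_mem_Ioc_zpow_mul {r x : ℝ} (hr : 1 < r) (hx : 0 < x) :
    ∃ m : ℤ, x ∈ Set.Ioc (r ^ m) (r * r ^ m) := by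
  obtain ⟨m, hm⟩ := exists_mem_Ioc_zpow hx hr
  rw [zpow_add_one₀ (by positivity), mul_comm] at hm
  exact ⟨m, hm⟩

lemma tsum_indicator_Ioc_zpow {r x : ℝ} (hr : 1 < r) (hx : 0 < x) :
    ∑' m : ℤ, (Set.Ioc (r ^ m) (r * r ^ m)).indicator (1 : ℝ → ℝ≥0∞) x = 1 := by
  obtain ⟨m, hm⟩ := exists_mem_Ioc_zpow_mul hr hx
  rw [tsum_eq_single m fun n hn => Set.indicator_of_notMem
    (fun h => Set.disjoint_left.1 (disjoint_Ioc_zpow hr hn) h hm) _]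
  simp [hm]

lemma tsum_setLIntegral_Ioc_zpow {r : ℝ} (hr : 1 < r) (f : ℝ → ℝ≥0∞) :
    ∑' m : ℤ, ∫⁻ z in Set.Ioc (r ^ m) (r * r ^ m), f z ∂inverseSquareMeasure =
      ∫⁻ z, f z ∂inverseSquareMeasure := by
  rw [← lintegral_iUnion (fun m => measurableSet_Ioc) (disjoint_Ioc_zpow hr)]
  congr 1
  refine Measure.restrict_eq_self_of_ae_mem ?_
  filter_upwards [ae_pos_inverseSquareMeasure] with z hz
  exact Set.mem_iUnion.2 (exists_mem_Ioc_zpow_mul hr hz)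

lemma div_ofReal_mul (c : ℝ≥0∞) {t : ℝ} (ht : 0 < t) (z : ℝ) :
    c / ENNReal.ofReal (t * z) = c / ENNReal.ofReal t / ENNReal.ofReal z := by
  rw [ENNReal.ofReal_mul ht.le, div_eq_mul_inv, ENNReal.mul_inv (by simp [ht]) (by simp),
    ← mul_assoc, ← div_eq_mul_inv, ← div_eq_mul_inv]

lemma lintegral_expNeg_div_mul {c : ℝ≥0∞} (hc : c ≠ 0) {t : ℝ} (ht : 0 < t) :
    ∫⁻ z, expNeg (c / ENNReal.ofReal (t * z)) ∂inverseSquareMeasure =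
      ENNReal.ofReal t * c⁻¹ := by
  simp_rw [div_ofReal_mul c ht]
  rw [lintegral_expNeg_div (by simp [hc]), ENNReal.inv_div (by simp) (by simp [ht]),
    div_eq_mul_inv]

lemma lintegral_one_sub_comp_div {G : ℝ → ℝ≥0∞} (hG : Measurable G) {z : ℝ} (hz : 0 < z) :
    ∫⁻ x, (1 - G (x / z)) ∂inverseSquareMeasure =
      (∫⁻ x, (1 - G x) ∂inverseSquareMeasure) / ENNReal.ofReal z :=
  lintegral_comp_div_inverseSquareMeasure (f := fun x => 1 - G x) (measurable_const.sub hG) hz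

lemma inverseSquareMeasure_Ioc_ne_top {a b : ℝ} (ha : 0 < a) :
    inverseSquareMeasure (Set.Ioc a b) ≠ ∞ := by
  refine ((measure_mono Set.Ioc_subset_Ioi_self).trans_lt ?_).ne
  rw [inverseSquareMeasure_Ioi_of_pos ha]
  simp [ha]

variable {Ω : Type*} [MeasurableSpace Ω] {ζ : ℕ → Ω → ℝ} {P : Measure Ω}

lemma IsPoissonProcess.ae_pos (h : IsPoissonProcess ζ inverseSquareMeasure P)
    [IsProbabilityMeasure P] : ∀ᵐ ω ∂P, ∀ i, 0 < ζ i ω := by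
  have h0 := h.poisson (Set.Iic 0) measurableSet_Iic (by simp [inverseSquareMeasure_Iic]) 0
  rw [inverseSquareMeasure_Iic, poissonMeasure_singleton] at h0
  have h1 : ∀ᵐ ω ∂P, pointCount ζ (Set.Iic 0) ω = (0 : ℕ) := by
    rw [ae_iff, ← Set.compl_ofPred, prob_compl_eq_zero_iff]
    · simpa using h0
    · exact measurable_pointCount h.measurable measurableSet_Iic (measurableSet_singleton _)
  filter_upwards [h1] with ω hω i
  by_contra hi
  rw [pointCount, Nat.cast_zero, Set.encard_eq_zero] at hω
  exact Set.eq_empty_iff_forall_notMem.1 hω i (not_lt.1 hi)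

variable [IsProbabilityMeasure P] {G : ℝ → ℝ≥0∞}

/-- For ζ_l in the cell, G(ζ_i/ζ_l) is at least G(r) if ζ_i is in the cell, and at least G(ζ_i/b)
otherwise. This minorant `g` does not depend on ζ_l and is constant on the cell, so the Mecke
formula applies. Since g(x) ≥ G(x/(b/r)) and b/r ≥ z/r² on the cell, the loss is a factor r² in z.
-/
lemma le_lintegral_cell (h : IsPoissonProcess ζ inverseSquareMeasure P) (hG : Measurable G)
    (hG1 : ∀ x, G x ≤ 1) (hanti : AntitoneOn G (Set.Ioi 0)) {r b : ℝ} (hr : 1 < r) (hb : 0 < b) :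
    ∫⁻ z in Set.Ioc b (r * b), expNeg ((∫⁻ x, (1 - G x) ∂inverseSquareMeasure) /
        ENNReal.ofReal ((r ^ 2)⁻¹ * z)) ∂inverseSquareMeasure ≤
      ∫⁻ ω, ∑' l, (Set.Ioc b (r * b)).indicator 1 (ζ l ω) *
        ∏' i, (if i = l then 1 else G (ζ i ω / ζ l ω)) ∂P := by
  classical
  have hr0 : 0 < r := zero_lt_one.trans hr
  let g : ℝ → ℝ≥0∞ := fun x => if x ∈ Set.Ioc b (r * b) then G r else G (x / b)
  have hg : Measurable g := Measurable.ite measurableSet_Ioc measurable_const (by fun_prop)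
  have hg1 : ∀ x, g x ≤ 1 := fun x => by simp only [g]; split_ifs <;> exact hG1 _
  have hlow : ∀ x, 0 < x → G (x / (b / r)) ≤ g x := by
    intro x hx
    simp only [g]
    split_ifs with hxB
    · refine hanti (Set.mem_Ioi.2 hr0) (Set.mem_Ioi.2 (by positivity)) ?_
      rw [le_div_iff₀ (by positivity), mul_div_cancel₀ _ hr0.ne']
      exact hxB.1.le
    · refine hanti (Set.mem_Ioi.2 (by positivity)) (Set.mem_Ioi.2 (by positivity)) ?_
      exact div_le_div_of_nonneg_left hx.le (by positivity) (div_le_self hb.le hr.le)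
  calc _ ≤ ∫⁻ z in Set.Ioc b (r * b), expNeg ((∫⁻ x, (1 - G x) ∂inverseSquareMeasure) /
        ENNReal.ofReal (b / r)) ∂inverseSquareMeasure := by
        refine setLIntegral_mono' measurableSet_Ioc fun z hz => expNeg_antitone ?_
        refine ENNReal.div_le_div_left (ENNReal.ofReal_le_ofReal ?_) _
        rw [inv_mul_le_iff₀ (by positivity), pow_two, mul_assoc, mul_div_cancel₀ _ hr0.ne']
        exact hz.2
    _ = inverseSquareMeasure (Set.Ioc b (r * b)) *
        expNeg (∫⁻ x, (1 - G (x / (b / r))) ∂inverseSquareMeasure) := by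
        rw [setLIntegral_const, lintegral_one_sub_comp_div hG (by positivity), mul_comm]
    _ ≤ inverseSquareMeasure (Set.Ioc b (r * b)) *
        expNeg (∫⁻ x, (1 - g x) ∂inverseSquareMeasure) := by
        gcongr
        refine expNeg_antitone (lintegral_mono_ae ?_)
        filter_upwards [ae_pos_inverseSquareMeasure] with x hx
        exact tsub_le_tsub_left (hlow x hx) 1
    _ = ∫⁻ ω, ∑' l, (Set.Ioc b (r * b)).indicator 1 (ζ l ω) *
        ∏' i, (if i = l then 1 else g (ζ i ω)) ∂P :=
        (h.lintegral_tsum_indicator_mul_tprod measurableSet_Ioc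
          (inverseSquareMeasure_Ioc_ne_top hb) hg hg1 (a := G r)
          (fun x hx => if_pos hx)).symm
    _ ≤ _ := by
        refine lintegral_mono_ae ?_
        filter_upwards [h.ae_pos] with ω hω
        refine ENNReal.tsum_le_tsum fun l => ?_
        by_cases hl : ζ l ω ∈ Set.Ioc b (r * b)
        · refine mul_le_mul' le_rfl (tprod_mono_of_le_one (fun i => ?_) fun i => ?_)
          · split_ifs with hil
            · exact le_rfl
            · have hpos : 0 < ζ i ω / ζ l ω := div_pos (hω i) (hω l)
              simp only [g]
              split_ifs with hi
              · refine hanti (Set.mem_Ioi.2 hpos) (Set.mem_Ioi.2 hr0) ?_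
                rw [div_le_iff₀ (hω l)]
                exact hi.2.trans (mul_le_mul_of_nonneg_left hl.1.le hr0.le)
              · refine hanti (Set.mem_Ioi.2 hpos) (Set.mem_Ioi.2 (div_pos (hω i) hb)) ?_
                exact div_le_div_of_nonneg_left (hω i).le hb hl.1.le
          · split_ifs
            · exact le_rfl
            · exact hG1 _
        · simp [Set.indicator_of_notMem hl]

/-- The mirror image: quotients within the cell are at least r⁻¹, and outside it ζ_l is replaced by
the right endpoint r b. -/
lemma lintegral_cell_le (h : IsPoissonProcess ζ inverseSquareMeasure P) (hG : Measurable G)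
    (hG1 : ∀ x, G x ≤ 1) (hanti : AntitoneOn G (Set.Ioi 0)) {r b : ℝ} (hr : 1 < r) (hb : 0 < b) :
    ∫⁻ ω, ∑' l, (Set.Ioc b (r * b)).indicator 1 (ζ l ω) *
        ∏' i, (if i = l then 1 else G (ζ i ω / ζ l ω)) ∂P ≤
      ∫⁻ z in Set.Ioc b (r * b), expNeg ((∫⁻ x, (1 - G x) ∂inverseSquareMeasure) /
        ENNReal.ofReal (r ^ 2 * z)) ∂inverseSquareMeasure := by
  classical
  have hr0 : 0 < r := zero_lt_one.trans hr
  let g : ℝ → ℝ≥0∞ := fun x => if x ∈ Set.Ioc b (r * b) then G r⁻¹ else G (x / (r * b))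
  have hg : Measurable g := Measurable.ite measurableSet_Ioc measurable_const (by fun_prop)
  have hg1 : ∀ x, g x ≤ 1 := fun x => by simp only [g]; split_ifs <;> exact hG1 _
  have hup : ∀ x, 0 < x → g x ≤ G (x / (r ^ 2 * b)) := by
    intro x hx
    simp only [g]
    split_ifs with hxB
    · refine hanti (Set.mem_Ioi.2 (by positivity)) (Set.mem_Ioi.2 (by positivity)) ?_
      rw [div_le_iff₀ (by positivity), pow_two, mul_assoc, inv_mul_cancel_left₀ hr0.ne']
      exact hxB.2
    · refine hanti (Set.mem_Ioi.2 (by positivity)) (Set.mem_Ioi.2 (by positivity)) ?_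
      refine div_le_div_of_nonneg_left hx.le (by positivity) ?_
      refine mul_le_mul_of_nonneg_right ?_ hb.le
      exact le_self_pow₀ hr.le two_ne_zero
  calc _ ≤ ∫⁻ ω, ∑' l, (Set.Ioc b (r * b)).indicator 1 (ζ l ω) *
        ∏' i, (if i = l then 1 else g (ζ i ω)) ∂P := by
        refine lintegral_mono_ae ?_
        filter_upwards [h.ae_pos] with ω hω
        refine ENNReal.tsum_le_tsum fun l => ?_
        by_cases hl : ζ l ω ∈ Set.Ioc b (r * b)
        · refine mul_le_mul' le_rfl (tprod_mono_of_le_one (fun i => ?_) fun i => ?_)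
          · split_ifs with hil
            · exact le_rfl
            · have hpos : 0 < ζ i ω / ζ l ω := div_pos (hω i) (hω l)
              simp only [g]
              split_ifs with hi
              · refine hanti (Set.mem_Ioi.2 (by positivity)) (Set.mem_Ioi.2 hpos) ?_
                rw [le_div_iff₀ (hω l), inv_mul_le_iff₀ hr0]
                exact hl.2.trans (mul_le_mul_of_nonneg_left hi.1.le hr0.le)
              · refine hanti (Set.mem_Ioi.2 (div_pos (hω i) (by positivity)))
                  (Set.mem_Ioi.2 hpos) ?_
                exact div_le_div_of_nonneg_left (hω i).le (hω l) hl.2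
          · split_ifs
            · exact le_rfl
            · exact hg1 _
        · simp [Set.indicator_of_notMem hl]
    _ = inverseSquareMeasure (Set.Ioc b (r * b)) *
        expNeg (∫⁻ x, (1 - g x) ∂inverseSquareMeasure) :=
        h.lintegral_tsum_indicator_mul_tprod measurableSet_Ioc
          (inverseSquareMeasure_Ioc_ne_top hb) hg hg1 (a := G r⁻¹) (fun x hx => if_pos hx)
    _ ≤ inverseSquareMeasure (Set.Ioc b (r * b)) *
        expNeg (∫⁻ x, (1 - G (x / (r ^ 2 * b))) ∂inverseSquareMeasure) := by
        gcongr
        refine expNeg_antitone (lintegral_mono_ae ?_)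
        filter_upwards [ae_pos_inverseSquareMeasure] with x hx
        exact tsub_le_tsub_left (hup x hx) 1
    _ = ∫⁻ z in Set.Ioc b (r * b), expNeg ((∫⁻ x, (1 - G x) ∂inverseSquareMeasure) /
        ENNReal.ofReal (r ^ 2 * b)) ∂inverseSquareMeasure := by
        rw [setLIntegral_const, lintegral_one_sub_comp_div hG (by positivity), mul_comm]
    _ ≤ _ := by
        refine setLIntegral_mono' measurableSet_Ioc fun z hz => expNeg_antitone ?_
        refine ENNReal.div_le_div_left (ENNReal.ofReal_le_ofReal ?_) _
        exact mul_le_mul_of_nonneg_left hz.1.le (by positivity)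

lemma lintegral_tsum_tprod_eq_tsum_cell (h : IsPoissonProcess ζ inverseSquareMeasure P)
    (hG : Measurable G) (hG1 : ∀ x, G x ≤ 1) {r : ℝ} (hr : 1 < r) :
    ∫⁻ ω, ∑' l, ∏' i, (if i = l then 1 else G (ζ i ω / ζ l ω)) ∂P =
      ∑' m : ℤ, ∫⁻ ω, ∑' l, (Set.Ioc (r ^ m) (r * r ^ m)).indicator 1 (ζ l ω) *
        ∏' i, (if i = l then 1 else G (ζ i ω / ζ l ω)) ∂P := by
  have hm := h.measurable
  rw [← lintegral_tsum]
  · refine lintegral_congr_ae ?_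
    filter_upwards [h.ae_pos] with ω hω
    rw [ENNReal.tsum_comm]
    refine tsum_congr fun l => ?_
    rw [ENNReal.tsum_mul_right, tsum_indicator_Ioc_zpow hr (hω l), one_mul]
  · refine fun m => (Measurable.tsum fun l => Measurable.mul ?_ ?_).aemeasurable
    · exact (measurable_one.indicator measurableSet_Ioc).comp (hm l)
    · refine measurable_tprod_of_le_one (fun i => ?_) fun i ω => ?_
      · split_ifs
        · exact measurable_const
        · exact hG.comp ((hm i).div (hm l))
      · split_ifs
        · exact le_rfl
        · exact hG1 _

/-- For a Poisson process with intensity `z⁻² dz`, the expected sum over all points `z` of the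
product of `G (x / z)` over all other points `x` is the inverse of `∫ (1 - G x) x⁻² dx`. -/
theorem lintegral_tsum_tprod_div (h : IsPoissonProcess ζ inverseSquareMeasure P)
    (hG : Measurable G) (hG1 : ∀ x, G x ≤ 1) (hanti : AntitoneOn G (Set.Ioi 0))
    (hc : ∫⁻ x, (1 - G x) ∂inverseSquareMeasure ≠ 0) :
    ∫⁻ ω, ∑' l, ∏' i, (if i = l then 1 else G (ζ i ω / ζ l ω)) ∂P =
      (∫⁻ x, (1 - G x) ∂inverseSquareMeasure)⁻¹ := by
  -- As ∫ exp(-c/(t z)) z⁻² dz = t/c, the factors t = r^(±2) lost on each cell reappear as factors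
  -- on 1/c after summation, and vanish as r decreases to 1.
  have hlow : ∀ r : ℝ, 1 < r → ENNReal.ofReal (r ^ 2)⁻¹ *
      (∫⁻ x, (1 - G x) ∂inverseSquareMeasure)⁻¹ ≤
      ∫⁻ ω, ∑' l, ∏' i, (if i = l then 1 else G (ζ i ω / ζ l ω)) ∂P := by
    intro r hr
    rw [lintegral_tsum_tprod_eq_tsum_cell h hG hG1 hr,
      ← lintegral_expNeg_div_mul hc (by positivity), ← tsum_setLIntegral_Ioc_zpow hr]
    exact ENNReal.tsum_le_tsum fun m => le_lintegral_cell h hG hG1 hanti hr (by positivity)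
  have hup : ∀ r : ℝ, 1 < r → ∫⁻ ω, ∑' l, ∏' i, (if i = l then 1 else G (ζ i ω / ζ l ω)) ∂P ≤
      ENNReal.ofReal (r ^ 2) * (∫⁻ x, (1 - G x) ∂inverseSquareMeasure)⁻¹ := by
    intro r hr
    rw [lintegral_tsum_tprod_eq_tsum_cell h hG hG1 hr,
      ← lintegral_expNeg_div_mul hc (by positivity), ← tsum_setLIntegral_Ioc_zpow hr]
    exact ENNReal.tsum_le_tsum fun m => lintegral_cell_le h hG hG1 hanti hr (by positivity)
  have hlim : ∀ f : ℝ → ℝ, ContinuousAt f 1 → f 1 = 1 → Filter.Tendsto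
      (fun r => ENNReal.ofReal (f r) * (∫⁻ x, (1 - G x) ∂inverseSquareMeasure)⁻¹)
      (nhdsWithin 1 (Set.Ioi 1)) (nhds (∫⁻ x, (1 - G x) ∂inverseSquareMeasure)⁻¹) := by
    intro f hf hf1
    have h1 := (ENNReal.continuous_ofReal.tendsto _).comp
      (hf.tendsto.mono_left (nhdsWithin_le_nhds (s := Set.Ioi 1)))
    have h2 := ENNReal.Tendsto.mul_const (b := (∫⁻ x, (1 - G x) ∂inverseSquareMeasure)⁻¹) h1
      (Or.inr (by simpa using hc))
    simpa [hf1] using h2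
  refine le_antisymm ?_ ?_
  · refine ge_of_tendsto (hlim (fun r => r ^ 2) (by fun_prop) (by norm_num)) ?_
    filter_upwards [self_mem_nhdsWithin] with r hr using hup r hr
  · refine le_of_tendsto (hlim (fun r => (r ^ 2)⁻¹) ?_ (by norm_num)) ?_
    · exact ContinuousAt.inv₀ (by fun_prop) (by norm_num)
    · filter_upwards [self_mem_nhdsWithin] with r hr using hlow r hr

end Concurrence

namespace Concurrence

/-! ### Independent marks -/

lemma measurable_update_snd_fst {E : Type*} [MeasurableSpace E] (l : ℕ) :
    Measurable fun p : E × (ℕ → E) => Function.update p.2 l p.1 := by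
  refine measurable_pi_iff.2 fun i => ?_
  by_cases hi : i = l
  · subst hi; simpa using measurable_fst
  · simp only [Function.update_of_ne hi]
    fun_prop

section Marks

variable {E : Type*} [MeasurableSpace E] (Q : Measure E) [IsProbabilityMeasure Q]

/-- Resampling one coordinate of an i.i.d. sequence preserves its law; this isolates the mark of the
candidate `l` from the marks of its competitors. -/
lemma map_update_prod_infinitePi (l : ℕ) :
    (Q.prod (Measure.infinitePi fun _ : ℕ => Q)).map (fun p => Function.update p.2 l p.1) =
      Measure.infinitePi fun _ : ℕ => Q := by
  have hm := measurable_update_snd_fst (E := E) l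
  refine Measure.eq_infinitePi _ fun s t ht => ?_
  rw [Measure.map_apply hm (.pi s.countable_toSet fun i _ => ht i)]
  by_cases hl : l ∈ s
  · have hset : (fun p : E × (ℕ → E) => Function.update p.2 l p.1) ⁻¹' Set.pi s t =
        t l ×ˢ Set.pi (s.erase l) t := by
      ext p
      simp only [Set.mem_preimage, Set.mem_pi, Set.mem_prod, Finset.mem_coe, Finset.mem_erase]
      refine ⟨fun h => ⟨by simpa using h l hl, fun i hi => ?_⟩, fun h i hi => ?_⟩
      · simpa [Function.update_of_ne hi.1] using h i hi.2
      · by_cases hil : i = l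
        · subst hil; simpa using h.1
        · simpa [Function.update_of_ne hil] using h.2 i ⟨hil, hi⟩
    rw [hset, Measure.prod_prod, Measure.infinitePi_pi _ fun i _ => ht i,
      Finset.mul_prod_erase s (fun i => Q (t i)) hl]
  · have hset : (fun p : E × (ℕ → E) => Function.update p.2 l p.1) ⁻¹' Set.pi s t =
        Set.univ ×ˢ Set.pi s t := by
      ext p
      simp only [Set.mem_preimage, Set.mem_pi, Set.mem_prod, Finset.mem_coe, Set.mem_univ,
        true_and]
      refine forall₂_congr fun i hi => ?_
      rw [Function.update_of_ne (by rintro rfl; exact hl hi)]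
    rw [hset, Measure.prod_prod, measure_univ, one_mul, Measure.infinitePi_pi _ fun i _ => ht i]

lemma infinitePi_forall_ne_mem (l : ℕ) {R : ℕ → Set (E × E)} (hR : ∀ i, MeasurableSet (R i)) :
    Measure.infinitePi (fun _ : ℕ => Q) {w | ∀ i, i ≠ l → (w i, w l) ∈ R i} =
      ∫⁻ v, ∏' i, (if i = l then 1 else Q {u | (u, v) ∈ R i}) ∂Q := by
  have hm := measurable_update_snd_fst (E := E) l
  have hA : MeasurableSet {w : ℕ → E | ∀ i, i ≠ l → (w i, w l) ∈ R i} := by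
    simp only [Set.ofPred_forall]
    exact MeasurableSet.iInter fun i => MeasurableSet.iInter fun _ =>
      ((measurable_pi_apply i).prodMk (measurable_pi_apply l)) (hR i)
  have h := Measure.map_apply (μ := Q.prod (Measure.infinitePi fun _ : ℕ => Q)) hm hA
  rw [map_update_prod_infinitePi] at h
  rw [h, Measure.prod_apply (hm hA)]
  refine lintegral_congr fun v => ?_
  have hset : Prod.mk v ⁻¹' ((fun p : E × (ℕ → E) => Function.update p.2 l p.1) ⁻¹'
      {w : ℕ → E | ∀ i, i ≠ l → (w i, w l) ∈ R i}) =
      Set.univ.pi fun i => if i = l then Set.univ else {u | (u, v) ∈ R i} := by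
    ext w
    simp only [Set.mem_preimage, Set.mem_ofPred_eq, Function.update_self, Set.mem_pi, Set.mem_univ,
      true_imp_iff]
    refine forall_congr' fun i => ?_
    by_cases hi : i = l
    · simp [hi]
    · simp [hi]
  rw [hset, Measure.infinitePi_pi_univ]
  · refine tprod_congr fun i => ?_
    split_ifs <;> simp
  · intro i
    split_ifs
    · exact .univ
    · exact measurable_prodMk_right (hR i)

end Marks

/-! ### Expected numbers of dominating points -/

section Domination

variable {Ω : Type*} [MeasurableSpace Ω] {ζ : ℕ → Ω → ℝ} {P : Measure Ω} [IsProbabilityMeasure P]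
  {k : ℕ} (Q : Measure (Fin k → ℝ)) [IsProbabilityMeasure Q]

/-- The outcomes for which the scaled mark with index `l` dominates all others with respect to
the relation `D`. -/
def dominating (ζ : ℕ → Ω → ℝ) (D : Set ((Fin k → ℝ) × (Fin k → ℝ))) (l : ℕ) :
    Set (Ω × (ℕ → Fin k → ℝ)) :=
  {p | ∀ i, i ≠ l → (ζ i p.1 • p.2 i, ζ l p.1 • p.2 l) ∈ D}

lemma measurableSet_dominating (hζ : ∀ i, Measurable (ζ i))
    {D : Set ((Fin k → ℝ) × (Fin k → ℝ))} (hD : MeasurableSet D) (l : ℕ) :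
    MeasurableSet (dominating ζ D l) := by
  simp only [dominating, Set.ofPred_forall]
  refine MeasurableSet.iInter fun i => MeasurableSet.iInter fun _ => ?_
  have h : ∀ i, Measurable fun p : Ω × (ℕ → Fin k → ℝ) => ζ i p.1 • p.2 i := fun i =>
    ((hζ i).comp measurable_fst).smul ((measurable_pi_apply i).comp measurable_snd)
  exact ((h i).prodMk (h l)) hD

/-- The expected number of points whose scaled mark dominates all the others. -/
theorem tsum_measure_dominating (h : IsPoissonProcess ζ inverseSquareMeasure P)
    (hQ : ∀ᵐ u ∂Q, 0 ≤ u) {D : Set ((Fin k → ℝ) × (Fin k → ℝ))} (hD : MeasurableSet D)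
    (hscale : ∀ t : ℝ, 0 < t → ∀ u v, (u, v) ∈ D → (t • u, t • v) ∈ D)
    (hanti : ∀ u u' v, u ≤ u' → (u', v) ∈ D → (u, v) ∈ D)
    (hc : ∀ᵐ v ∂Q, ∫⁻ u, inverseSquareMeasure {x | (x • u, v) ∉ D} ∂Q ≠ 0) :
    ∑' l, (P.prod (Measure.infinitePi fun _ : ℕ => Q)) (dominating ζ D l) =
      ∫⁻ v, (∫⁻ u, inverseSquareMeasure {x | (x • u, v) ∉ D} ∂Q)⁻¹ ∂Q := by
  have hm := h.measurable
  have hprob : ∀ A : Set (Fin k → ℝ), Q A ≤ 1 := fun A => prob_le_one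
  have hmeas : ∀ i l, Measurable fun p : Ω × (Fin k → ℝ) =>
      Q {u | (ζ i p.1 • u, ζ l p.1 • p.2) ∈ D} := by
    intro i l
    have hS : MeasurableSet {q : (Ω × (Fin k → ℝ)) × (Fin k → ℝ) |
        (ζ i q.1.1 • q.2, ζ l q.1.1 • q.1.2) ∈ D} := by
      refine Measurable.prodMk ?_ ?_ hD
      · exact ((hm i).comp (measurable_fst.comp measurable_fst)).smul measurable_snd
      · exact ((hm l).comp (measurable_fst.comp measurable_fst)).smul
          (measurable_snd.comp measurable_fst)
    exact measurable_measure_prodMk_left hS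
  have htprod : ∀ l, Measurable fun p : Ω × (Fin k → ℝ) =>
      ∏' i, (if i = l then 1 else Q {u | (ζ i p.1 • u, ζ l p.1 • p.2) ∈ D}) := by
    refine fun l => measurable_tprod_of_le_one (fun i => ?_) fun i p => ?_
    · split_ifs
      · exact measurable_const
      · exact hmeas i l
    · split_ifs
      · exact le_rfl
      · exact hprob _
  have h1 : ∀ l, (P.prod (Measure.infinitePi fun _ : ℕ => Q)) (dominating ζ D l) =
      ∫⁻ v, ∫⁻ ω, ∏' i, (if i = l then 1 else Q {u | (ζ i ω • u, ζ l ω • v) ∈ D}) ∂P ∂Q := by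
    intro l
    rw [Measure.prod_apply (measurableSet_dominating hm hD l),
      ← lintegral_lintegral_swap (htprod l).aemeasurable]
    refine lintegral_congr fun ω => ?_
    exact infinitePi_forall_ne_mem Q l (R := fun i => {q | (ζ i ω • q.1, ζ l ω • q.2) ∈ D})
      fun i => ((measurable_fst.const_smul (ζ i ω)).prodMk (measurable_snd.const_smul (ζ l ω))) hD
  simp_rw [h1]
  rw [← lintegral_tsum fun l => ((htprod l).lintegral_prod_left').aemeasurable]
  refine lintegral_congr_ae ?_
  filter_upwards [hc] with v hv
  have htv : ∀ l, Measurable fun ω =>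
      ∏' i, (if i = l then 1 else Q {u | (ζ i ω • u, ζ l ω • v) ∈ D}) := fun l =>
    (htprod l).comp measurable_prodMk_right
  rw [← lintegral_tsum fun l => (htv l).aemeasurable]
  let G : ℝ → ℝ≥0∞ := fun t => Q {u | (t • u, v) ∈ D}
  have hS : MeasurableSet {q : ℝ × (Fin k → ℝ) | (q.1 • q.2, v) ∈ D} :=
    ((measurable_fst.smul measurable_snd).prodMk measurable_const) hD
  have hG : Measurable G := measurable_measure_prodMk_left hS
  have hGanti : Antitone G := by
    intro s t hst
    refine measure_mono_ae ?_
    filter_upwards [hQ] with u hu ht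
    exact hanti _ _ _ (smul_le_smul_of_nonneg_right hst hu) ht
  -- Both sides are the product measure of the pairs (x, u) with (x • u, v) ∉ D.
  have hint : ∫⁻ x, (1 - G x) ∂inverseSquareMeasure =
      ∫⁻ u, inverseSquareMeasure {x | (x • u, v) ∉ D} ∂Q := by
    have h2 := Measure.prod_apply (μ := inverseSquareMeasure) (ν := Q) hS.compl
    have h3 := Measure.prod_apply_symm (μ := inverseSquareMeasure) (ν := Q) hS.compl
    rw [h3] at h2
    refine Eq.trans (lintegral_congr fun x => ?_) h2.symm
    exact (prob_compl_eq_one_sub (measurable_prodMk_left hS)).symm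
  rw [← hint] at hv ⊢
  rw [← lintegral_tsum_tprod_div h hG (fun x => hprob _) (hGanti.antitoneOn _) hv]
  refine lintegral_congr_ae ?_
  filter_upwards [h.ae_pos] with ω hω
  refine tsum_congr fun l => tprod_congr fun i => ?_
  split_ifs
  · rfl
  -- Since D is invariant under positive scaling, both vectors can be divided by ζ_l, so that only
  -- the quotient ζ_i/ζ_l matters.
  · simp only [G]
    congr 1
    ext u
    simp only [Set.mem_ofPred_eq]
    constructor
    · intro hu
      have := hscale (ζ l ω)⁻¹ (inv_pos.2 (hω l)) _ _ hu
      rwa [smul_smul, smul_smul, inv_mul_cancel₀ (hω l).ne', one_smul, inv_mul_eq_div] at this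
    · intro hu
      have := hscale (ζ l ω) (hω l) _ _ hu
      rwa [smul_smul, mul_div_cancel₀ _ (hω l).ne'] at this

/-- The failure sets of the coordinates are upper sets of the line, hence nested, so their union has
the largest of their measures. This is where the maximum over j arises. -/
lemma inverseSquareMeasure_not_smul_le {u v : Fin k → ℝ} (hu : 0 ≤ u) (hv : 0 ≤ v) :
    inverseSquareMeasure {x | ¬ x • u ≤ v} =
      ⨆ j, ENNReal.ofReal (u j) / ENNReal.ofReal (v j) := by
  have hset : {x : ℝ | ¬ x • u ≤ v} = ⋃ j, {x | v j < x * u j} := by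
    ext x; simp [Pi.le_def]
  have hup : ∀ j, IsUpperSet {x | v j < x * u j} := fun j x y hxy hx =>
    lt_of_lt_of_le hx (mul_le_mul_of_nonneg_right hxy (hu j))
  rw [hset, Directed.measure_iUnion]
  · exact iSup_congr fun j => inverseSquareMeasure_lt_mul (hu j) (hv j)
  · intro i j
    rcases (hup i).total (hup j) with h | h
    · exact ⟨j, h, subset_rfl⟩
    · exact ⟨i, subset_rfl, h⟩

lemma inverseSquareMeasure_not_smul_lt {u v : Fin k → ℝ} (hu : 0 ≤ u) (hv : ∀ j, 0 < v j) :
    inverseSquareMeasure {x | ¬ ∀ j, (x • u) j < v j} =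
      ⨆ j, ENNReal.ofReal (u j) / ENNReal.ofReal (v j) := by
  have hset : {x : ℝ | ¬ ∀ j, (x • u) j < v j} = ⋃ j, {x | v j ≤ x * u j} := by
    ext x; simp
  have hup : ∀ j, IsUpperSet {x | v j ≤ x * u j} := fun j x y hxy hx =>
    le_trans hx (mul_le_mul_of_nonneg_right hxy (hu j))
  rw [hset, Directed.measure_iUnion]
  · exact iSup_congr fun j => inverseSquareMeasure_le_mul (hu j) (hv j)
  · intro i j
    rcases (hup i).total (hup j) with h | h
    · exact ⟨j, h, subset_rfl⟩
    · exact ⟨i, subset_rfl, h⟩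

/-- The probability that one of the scaled marks dominates all the others coordinatewise. -/
theorem measure_iUnion_dominating_le (h : IsPoissonProcess ζ inverseSquareMeasure P)
    (hk : 0 < k) (hQ : ∀ᵐ u ∂Q, 0 ≤ u) (hmean : ∀ j, ∫⁻ u, ENNReal.ofReal (u j) ∂Q ≠ 0) :
    (P.prod (Measure.infinitePi fun _ : ℕ => Q)) (⋃ l, dominating ζ {q | q.1 ≤ q.2} l) =
      ∫⁻ v, (∫⁻ u, ⨆ j, ENNReal.ofReal (u j) / ENNReal.ofReal (v j) ∂Q)⁻¹ ∂Q := by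
  let j₀ : Fin k := ⟨0, hk⟩
  let D₁ : Set ((Fin k → ℝ) × (Fin k → ℝ)) := {q | q.1 ≤ q.2}
  let D₂ : Set ((Fin k → ℝ) × (Fin k → ℝ)) := {q | ∀ j, q.1 j < q.2 j}
  have hD₁ : MeasurableSet D₁ := measurableSet_le measurable_fst measurable_snd
  have hD₂ : MeasurableSet D₂ := by
    simp only [D₂, Set.ofPred_forall]
    exact MeasurableSet.iInter fun j => measurableSet_lt
      ((measurable_pi_apply j).comp measurable_fst) ((measurable_pi_apply j).comp measurable_snd)
  have hD : D₂ ⊆ D₁ := fun q hq j => (hq j).le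
  have hpos : ∀ j, ∃ᵐ u ∂Q, ENNReal.ofReal (u j) ≠ 0 := by
    intro j hj
    refine hmean j ?_
    rw [lintegral_congr_ae (g := fun _ => 0) (hj.mono fun u hu => not_not.1 hu), lintegral_zero]
  have hmsup : ∀ v : Fin k → ℝ, Measurable fun u : Fin k → ℝ =>
      ⨆ j, ENNReal.ofReal (u j) / ENNReal.ofReal (v j) := fun v => by fun_prop
  have hc₁ : ∀ᵐ v ∂Q, ∫⁻ u, inverseSquareMeasure {x | (x • u, v) ∉ D₁} ∂Q =
      ∫⁻ u, ⨆ j, ENNReal.ofReal (u j) / ENNReal.ofReal (v j) ∂Q := by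
    filter_upwards [hQ] with v hv
    refine lintegral_congr_ae ?_
    filter_upwards [hQ] with u hu using inverseSquareMeasure_not_smul_le hu hv
  have hne : ∀ v : Fin k → ℝ, ∫⁻ u, ⨆ j, ENNReal.ofReal (u j) / ENNReal.ofReal (v j) ∂Q ≠ 0 := by
    intro v hv
    rw [lintegral_eq_zero_iff (hmsup v)] at hv
    refine hpos j₀ ?_
    filter_upwards [hv] with u hu
    have h1 := (iSup_eq_bot.1 hu) j₀
    exact not_not.2 (by simpa using h1)
  have hc₂ : ∀ᵐ v ∂Q, ∫⁻ u, inverseSquareMeasure {x | (x • u, v) ∉ D₂} ∂Q =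
      ∫⁻ u, ⨆ j, ENNReal.ofReal (u j) / ENNReal.ofReal (v j) ∂Q := by
    filter_upwards [hQ, hc₁] with v hv hv₁
    by_cases hv' : ∀ j, 0 < v j
    · refine lintegral_congr_ae ?_
      filter_upwards [hQ] with u hu using inverseSquareMeasure_not_smul_lt hu hv'
    -- If v_j = 0, both integrals are infinite: u_j > 0 with positive probability makes the quotient
    -- ∞, and strict domination fails wherever weak domination does.
    · obtain ⟨j, hj⟩ := not_forall.1 hv'
      have hj0 : v j = 0 := le_antisymm (not_lt.1 hj) (hv j)
      have htop : ∫⁻ u, ⨆ j, ENNReal.ofReal (u j) / ENNReal.ofReal (v j) ∂Q = ∞ := by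
        by_contra hfin
        refine hpos j ?_
        filter_upwards [ae_lt_top (hmsup v) hfin] with u hu hu0
        have h1 : ENNReal.ofReal (u j) / ENNReal.ofReal (v j) < ∞ :=
          (le_iSup (fun j => ENNReal.ofReal (u j) / ENNReal.ofReal (v j)) j).trans_lt hu
        rw [hj0, ENNReal.ofReal_zero, ENNReal.div_zero hu0] at h1
        exact lt_irrefl _ h1
      rw [htop, eq_top_iff, ← htop, ← hv₁]
      exact lintegral_mono fun u => measure_mono fun x hx hx' => hx (hD hx')
  have hsum₁ := tsum_measure_dominating Q h hQ hD₁
    (fun t ht u v (huv : u ≤ v) => (smul_le_smul_of_nonneg_left huv ht.le : t • u ≤ t • v))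
    (fun u u' v huu' hu' => huu'.trans hu') (hc₁.mono fun v hv => hv ▸ hne v)
  have hsum₂ := tsum_measure_dominating Q h hQ hD₂
    (fun t ht u v huv j => mul_lt_mul_of_pos_left (huv j) ht)
    (fun u u' v huu' hu' j => (huu' j).trans_lt (hu' j)) (hc₂.mono fun v hv => hv ▸ hne v)
  rw [lintegral_congr_ae (hc₁.mono fun v hv => congrArg Inv.inv hv)] at hsum₁
  rw [lintegral_congr_ae (hc₂.mono fun v hv => congrArg Inv.inv hv)] at hsum₂
  -- The sandwich: the union bound for weak domination from above, disjointness of the strict events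
  -- from below, with equal sums.
  refine le_antisymm ((measure_iUnion_le _).trans_eq hsum₁) ?_
  rw [← hsum₂, ← measure_iUnion _ fun l => measurableSet_dominating h.measurable hD₂ l]
  · exact measure_mono (Set.iUnion_mono fun l p hp i hi => hD (hp i hi))
  · intro l l' hll'
    refine Set.disjoint_left.2 fun p hp hp' => ?_
    exact lt_asymm (hp l' hll'.symm j₀) (hp' l hll' j₀)

end Domination

end Concurrence

/-! ### Reduction of the concurrence event to independent points and marks -/

namespace Concurrence

/-- With the supremum taken in `EReal` this holds for every outcome, so η need not be shown finite.
-/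
lemma exists_maxStable_eq_iff {Ω T : Type*} (ζ : ℕ → Ω → ℝ) (Ys : ℕ → Ω → T → ℝ)
    {k : ℕ} (s : Fin k → T) (ω : Ω) :
    (∃ l, ∀ j, maxStable ζ Ys ω (s j) = (spectralFunction ζ Ys l ω (s j) : EReal)) ↔
      ∃ l, ∀ i, i ≠ l → ζ i ω • (fun j => Ys i ω (s j)) ≤ ζ l ω • fun j => Ys l ω (s j) := by
  refine exists_congr fun l => ⟨fun h i _ j => ?_, fun h j => ?_⟩
  · have h1 : (spectralFunction ζ Ys i ω (s j) : EReal) ≤ maxStable ζ Ys ω (s j) :=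
      le_iSup (fun i => (spectralFunction ζ Ys i ω (s j) : EReal)) i
    rw [h j, EReal.coe_le_coe_iff] at h1
    exact h1
  · refine le_antisymm (iSup_le fun i => ?_)
      (le_iSup (fun i => (spectralFunction ζ Ys i ω (s j) : EReal)) l)
    rw [EReal.coe_le_coe_iff]
    by_cases hi : i = l
    · rw [hi]
    · exact h i hi j

variable {Ω T : Type*} [MeasurableSpace Ω] [TopologicalSpace T] {Y : Ω → T → ℝ} {P : Measure Ω}

lemma IsSpectralProcess.measurable_eval (h : IsSpectralProcess Y P) {k : ℕ} (s : Fin k → T) :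
    Measurable fun ω j => Y ω (s j) :=
  measurable_pi_iff.2 fun j => h.measurable (s j)

lemma IsSpectralProcess.lintegral_eq_one (h : IsSpectralProcess Y P) (s : T) :
    ∫⁻ ω, ENNReal.ofReal (Y ω s) ∂P = 1 := by
  have hint : Integrable (fun ω => Y ω s) P := by
    -- A non-integrable function would have Bochner integral 0, not 1.
    by_contra hni
    simpa [integral_undef hni] using h.mean_one s
  rw [← ofReal_integral_eq_lintegral_ofReal hint (Filter.Eventually.of_forall fun ω => h.nonneg ω s),
    h.mean_one, ENNReal.ofReal_one]

/-- In the concurrence probability, the points and the marks may be taken from different factors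
of a product space. -/
lemma IsSpectralRepresentation.extremalConcurrenceProb_eq {Ω' : Type*} [MeasurableSpace Ω']
    {Y : Ω' → T → ℝ} {P' : Measure Ω'} [IsProbabilityMeasure P] [IsProbabilityMeasure P']
    {ζ : ℕ → Ω → ℝ} {Ys : ℕ → Ω → T → ℝ} (h : IsSpectralRepresentation ζ Ys P Y P')
    {k : ℕ} (s : Fin k → T) :
    extremalConcurrenceProb ζ Ys P s =
      (P.prod (Measure.infinitePi fun _ : ℕ => P'.map fun ω j => Y ω (s j)))
        (⋃ l, dominating ζ {q | q.1 ≤ q.2} l) := by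
  let π : (T → ℝ) → Fin k → ℝ := fun y j => y (s j)
  have hπ : Measurable π := measurable_pi_iff.2 fun j => measurable_pi_apply (s j)
  have hζ : Measurable fun ω i => ζ i ω := measurable_pi_iff.2 h.poisson.measurable
  have hYs : ∀ i, Measurable fun ω => π (Ys i ω) := fun i => (h.spectral i).measurable_eval s
  have hYs' : Measurable fun ω i => π (Ys i ω) := measurable_pi_iff.2 hYs
  have hlaw : P.map (fun ω i => π (Ys i ω)) =
      Measure.infinitePi fun _ : ℕ => P'.map fun ω j => Y ω (s j) := by
    rw [(h.iIndep.comp (fun _ => π) fun _ => hπ).map_fun_eq_infinitePi_map hYs]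
    congr 1
    ext1 i
    exact ((h.identDistrib i).comp hπ).map_eq
  have hind : IndepFun (fun ω i => ζ i ω) (fun ω i => π (Ys i ω)) P :=
    h.indep.comp measurable_id
      (measurable_pi_iff.2 fun i => hπ.comp (measurable_pi_apply i) :
        Measurable fun (y : ℕ → T → ℝ) i => π (y i))
  rw [indepFun_iff_map_prod_eq_prod_map_map hζ.aemeasurable hYs'.aemeasurable, hlaw] at hind
  have hQ : IsProbabilityMeasure (P'.map fun ω j => Y ω (s j)) :=
    Measure.isProbabilityMeasure_map (hπ.comp_aemeasurable (h.identDistrib 0).aemeasurable_snd)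
  -- The event written on the space of pairs of sequences, with coordinates in place of ζ, so that
  -- its probability depends only on the joint law of points and marks.
  let S : Set ((ℕ → ℝ) × (ℕ → Fin k → ℝ)) :=
    ⋃ l, dominating (fun i z => z i) {q | q.1 ≤ q.2} l
  have hS : MeasurableSet S := MeasurableSet.iUnion fun l =>
    measurableSet_dominating measurable_pi_apply (measurableSet_le measurable_fst measurable_snd) l
  have h1 : extremalConcurrenceProb ζ Ys P s =
      P.map (fun ω => (fun i => ζ i ω, fun i => π (Ys i ω))) S := by
    rw [Measure.map_apply (hζ.prodMk hYs') hS, extremalConcurrenceProb]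
    congr 1
    ext ω
    exact (exists_maxStable_eq_iff ζ Ys s ω).trans (by simp [S, dominating, π])
  have h2 := Measure.map_prod_map P (Measure.infinitePi fun _ : ℕ => P'.map fun ω j => Y ω (s j))
    hζ measurable_id
  rw [Measure.map_id] at h2
  rw [h1, hind, h2, Measure.map_apply (hζ.prodMap measurable_id) hS]
  congr 1
  ext p
  simp [S, dominating]

end Concurrence

/-- Expectations and quotients on the right-hand side are taken in `[0, ∞]`, where `a / 0 = ∞` for
`a > 0` and `∞⁻¹ = 0`. `Y` and `Ytilde` have the same law and live on separate probability spaces,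
so that they are independent copies of each other on the product space. -/
theorem theorem2 {d : ℕ} (X : Set (EuclideanSpace ℝ (Fin d))) (hX : IsCompact X)
    {Ω Ω₁ Ω₂ : Type*} [MeasurableSpace Ω] [MeasurableSpace Ω₁] [MeasurableSpace Ω₂]
    (P : Measure Ω) [IsProbabilityMeasure P]
    (P₁ : Measure Ω₁) [IsProbabilityMeasure P₁]
    (P₂ : Measure Ω₂) [IsProbabilityMeasure P₂]
    (Y : Ω₁ → X → ℝ) (hY : Concurrence.IsSpectralProcess Y P₁)
    (Ytilde : Ω₂ → X → ℝ) (hYtilde : Concurrence.IsSpectralProcess Ytilde P₂)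
    (hcopy : IdentDistrib Ytilde Y P₂ P₁)
    (ζ : ℕ → Ω → ℝ) (Ys : ℕ → Ω → X → ℝ)
    (hrep : Concurrence.IsSpectralRepresentation ζ Ys P Y P₁)
    {k : ℕ} (hk : 2 ≤ k) (s : Fin k → X) :
    Concurrence.extremalConcurrenceProb ζ Ys P s =
      ∫⁻ ω₁, (∫⁻ ω₂, ⨆ j, ENNReal.ofReal (Ytilde ω₂ (s j)) / ENNReal.ofReal (Y ω₁ (s j))
        ∂P₂)⁻¹ ∂P₁ := by
  have hm₁ := hY.measurable_eval s
  have hm₂ := hYtilde.measurable_eval s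
  have hπ : Measurable fun (y : X → ℝ) (j : Fin k) => y (s j) :=
    measurable_pi_iff.2 fun j => measurable_pi_apply (s j)
  have hlaw : P₂.map (fun ω j => Ytilde ω (s j)) = P₁.map fun ω j => Y ω (s j) :=
    (hcopy.comp hπ).map_eq
  set Q := P₁.map fun ω j => Y ω (s j) with hQdef
  have hQ : IsProbabilityMeasure Q := Measure.isProbabilityMeasure_map hm₁.aemeasurable
  have hnonneg : ∀ᵐ u ∂Q, 0 ≤ u := by
    rw [hQdef, ae_map_iff hm₁.aemeasurable (p := fun u => 0 ≤ u)
      (measurableSet_le measurable_const measurable_id)]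
    exact Filter.Eventually.of_forall fun ω j => hY.nonneg ω (s j)
  have hmean : ∀ j, ∫⁻ u, ENNReal.ofReal (u j) ∂Q ≠ 0 := by
    intro j
    rw [hQdef, lintegral_map (by fun_prop) hm₁, hY.lintegral_eq_one]
    exact one_ne_zero
  have hmax : Measurable fun q : (Fin k → ℝ) × (Fin k → ℝ) =>
      ⨆ j, ENNReal.ofReal (q.2 j) / ENNReal.ofReal (q.1 j) := by fun_prop
  rw [hrep.extremalConcurrenceProb_eq s, Concurrence.measure_iUnion_dominating_le Q hrep.poisson
    (by omega) hnonneg hmean]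
  refine (lintegral_map (hmax.lintegral_prod_right' (ν := Q)).inv hm₁).trans ?_
  refine lintegral_congr fun ω₁ => ?_
  -- The inner integral uses the same law Q, now read as that of `Ytilde`.
  rw [← hlaw]
  exact congrArg Inv.inv (lintegral_map (hmax.comp measurable_prodMk_left) hm₂)
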